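/- Fix a constant $\delta>0$. There are a constant $K>0$ and an integer $N_0$, depending only on $\delta$, such that the following holds for all $N\ge N_0$ and all real $c$ with $1\le c\le N^{1-\delta}$. Any (possibly randomized) algorithm for matroid intersection on an $N$-element universe that makes at most $N^c$ rank-oracle queries per round and succeeds with probability at least $2/3$ on every input needs at least $K\,N^{1/3}/(c\log N)^{1/3}$ rounds; that is, it has $\Omega\big(N^{1/3}/(c\log N)^{1/3}\big)$ rounds of adaptivity. This is true even when both input matroids $\mathcal M_1,\mathcal M_2$ are promised to be nested matroids and the algorithm only has to output the value of the optimum, i.e. the largest cardinality of a common independent set of $\mathcal M_1$ and $\mathcal M_2$. Here a nested matroid on a universe $U$ is a matroid with independent sets $\{I\subseteq U: |I\cap C_t|\le \mathrm{cap}_t \text{ for } 1\le t\le r\}$ for some chain $U=C_1\supseteq C_2\supseteq\dots\supseteq C_r$ and nonnegative integers $\mathrm{cap}_1,\dots,\mathrm{cap}_r$ (a special kind of laminar matroid). A rank-oracle query names one of the two matroids and a set $S\subseteq U$, and is answered by the rank of $S$ in that matroid; the queries of a round may depend only on the algorithm's randomness and on the answers received in earlier rounds. -/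

import Mathlib

open MeasureTheory

/-! ### Nested matroids -/

/-- Exchange property of the set family `{I : |I ∩ C t| ≤ cap t for all t}` of a chain
`C 0 ⊇ C 1 ⊇ ⋯ ⊇ C m`. -/
theorem nested_exchange {U : Type*} [DecidableEq U] {m : ℕ} {C : Fin (m + 1) → Finset U}
    (hC : Antitone C) (cap : Fin (m + 1) → ℕ) {I J : Finset U}
    (hI : ∀ t, (I ∩ C t).card ≤ cap t) (hJ : ∀ t, (J ∩ C t).card ≤ cap t)
    (hIJ : I.card < J.card) :
    ∃ e ∈ J, e ∉ I ∧ ∀ t, (insert e I ∩ C t).card ≤ cap t := by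
  classical
  let T : Finset (Fin (m + 1)) := Finset.univ.filter fun t => cap t ≤ (I ∩ C t).card
  by_cases hT : T.Nonempty
  · -- the outermost tight set of the chain
    let t₀ := T.min' hT
    have ht₀ : cap t₀ ≤ (I ∩ C t₀).card := (Finset.mem_filter.1 (T.min'_mem hT)).2
    have hlt : (I \ C t₀).card < (J \ C t₀).card := by
      have h1 := Finset.card_inter_add_card_sdiff I (C t₀)
      have h2 := Finset.card_inter_add_card_sdiff J (C t₀)
      have h3 := hJ t₀
      omega
    obtain ⟨e, heJ, heI⟩ := Finset.exists_mem_notMem_of_card_lt_card hlt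
    rw [Finset.mem_sdiff] at heJ heI
    have heI' : e ∉ I := fun h => heI ⟨h, heJ.2⟩
    refine ⟨e, heJ.1, heI', fun t => ?_⟩
    by_cases het : e ∈ C t
    · have htT : t ∉ T := fun h => heJ.2 (hC (T.min'_le t h) het)
      have hlt' : (I ∩ C t).card < cap t := by
        by_contra hcon
        exact htT (Finset.mem_filter.2 ⟨Finset.mem_univ _, not_lt.1 hcon⟩)
      rw [Finset.insert_inter_of_mem het]
      exact (Finset.card_insert_le _ _).trans hlt'
    · rw [Finset.insert_inter_of_notMem het]
      exact hI t
  · obtain ⟨e, heJ, heI⟩ := Finset.exists_mem_notMem_of_card_lt_card hIJ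
    refine ⟨e, heJ, heI, fun t => ?_⟩
    have hlt' : (I ∩ C t).card < cap t := by
      by_contra hcon
      exact hT ⟨t, Finset.mem_filter.2 ⟨Finset.mem_univ _, not_lt.1 hcon⟩⟩
    have hsub : insert e I ∩ C t ⊆ insert e (I ∩ C t) := by
      intro x hx
      simp only [Finset.mem_inter, Finset.mem_insert] at hx ⊢
      tauto
    exact (Finset.card_le_card hsub).trans ((Finset.card_insert_le _ _).trans hlt')

/-- The matroid on the universe `U` whose independent sets are the sets `I` with
`|I ∩ C t| ≤ cap t` for all `t`, for a chain `C 0 ⊇ C 1 ⊇ ⋯ ⊇ C m`. -/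
def nestedMatroid {U : Type*} [DecidableEq U] {m : ℕ} (C : Fin (m + 1) → Finset U)
    (hC : Antitone C) (cap : Fin (m + 1) → ℕ) : Matroid U :=
  (IndepMatroid.ofFinset Set.univ (fun I => ∀ t, (I ∩ C t).card ≤ cap t)
    (fun t => by simp)
    (fun I _ hJ hIJ t => (Finset.card_le_card
      (Finset.inter_subset_inter_right (u := C t) hIJ)).trans (hJ t))
    (fun _ _ hI hJ hIJ => nested_exchange hC cap hI hJ hIJ)
    (fun _ _ => Set.subset_univ _)).matroid

/-- `M` is a nested matroid: it is given by a chain `U = C 0 ⊇ C 1 ⊇ ⋯ ⊇ C m` of subsets of the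
universe and nonnegative integer capacities. -/
def IsNestedMatroid {U : Type*} [Fintype U] [DecidableEq U] (M : Matroid U) : Prop :=
  ∃ (m : ℕ) (C : Fin (m + 1) → Finset U) (hC : Antitone C) (cap : Fin (m + 1) → ℕ),
    C 0 = Finset.univ ∧ M = nestedMatroid C hC cap

theorem nestedMatroid_indep_iff {U : Type*} [DecidableEq U] {m : ℕ}
    (C : Fin (m + 1) → Finset U) (hC : Antitone C) (cap : Fin (m + 1) → ℕ) (I : Finset U) :
    (nestedMatroid C hC cap).Indep (I : Set U) ↔ ∀ t, (I ∩ C t).card ≤ cap t := by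
  unfold nestedMatroid
  rw [IndepMatroid.matroid_Indep]
  exact IndepMatroid.ofFinset_indep _ _ _ _ _ _

open Classical in
/-- The optimum of matroid intersection: the largest cardinality of a set that is independent in
both matroids. -/
noncomputable def matroidIntersectionValue {U : Type*} [Fintype U] (M₁ M₂ : Matroid U) : ℕ :=
  ((Finset.univ : Finset (Finset U)).filter
    fun I : Finset U => M₁.Indep (I : Set U) ∧ M₂.Indep (I : Set U)).sup Finset.card

/-! ### Rank oracles and algorithms that work in rounds -/

/-- A rank query: `Sum.inl S` asks for the rank of `S` in the first matroid, `Sum.inr S` for the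
rank of `S` in the second one. -/
abbrev RankQuery (U : Type*) := Finset U ⊕ Finset U

/-- The answer of the rank oracles of `M₁` and `M₂` to a query. -/
noncomputable def rankAnswer {U : Type*} (M₁ M₂ : Matroid U) : RankQuery U → ℕ
  | Sum.inl S => (M₁.eRk (S : Set U)).toNat
  | Sum.inr S => (M₂.eRk (S : Set U)).toNat

/-- What an algorithm has seen so far: for each completed round, in order, the set of the queries
of that round together with their answers. -/
abbrev Transcript (U : Type*) := List (Finset (RankQuery U × ℕ))

/-- A deterministic algorithm working in rounds: the queries of the next round, and the number
that is output after the last round, are functions of the transcript of the earlier rounds.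
There is no restriction on the computation between the rounds. -/
structure RoundAlgorithm (U : Type*) where
  query : Transcript U → Finset (RankQuery U)
  output : Transcript U → ℕ

namespace RoundAlgorithm

variable {U : Type*} [DecidableEq U]

/-- The transcript after the first `k` rounds on the input `(M₁, M₂)`. -/
noncomputable def transcript (A : RoundAlgorithm U) (M₁ M₂ : Matroid U) : ℕ → Transcript U
  | 0 => []
  | k + 1 => A.transcript M₁ M₂ k ++
      [(A.query (A.transcript M₁ M₂ k)).image fun q => (q, rankAnswer M₁ M₂ q)]

/-- The queries made in round `k` (rounds are numbered from `0`) on the input `(M₁, M₂)`. -/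
noncomputable def roundQueries (A : RoundAlgorithm U) (M₁ M₂ : Matroid U) (k : ℕ) :
    Finset (RankQuery U) :=
  A.query (A.transcript M₁ M₂ k)

/-- The output on the input `(M₁, M₂)` after `s` rounds. -/
noncomputable def result (A : RoundAlgorithm U) (M₁ M₂ : Matroid U) (s : ℕ) : ℕ :=
  A.output (A.transcript M₁ M₂ s)

end RoundAlgorithm

/-- The random choice `ω ↦ A ω` of a deterministic algorithm is a randomized `s`-round algorithm
that, on each pair of nested matroids on `U`, makes at most `Q` rank queries in each round (for
all outcomes of its randomness), has a random variable as output, and outputs the value of the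
matroid intersection optimum with probability at least `2/3`. -/
structure SolvesNestedMatroidIntersection {U : Type*} [Fintype U] [DecidableEq U]
    {Ω : Type*} [MeasurableSpace Ω] (P : Measure Ω) (A : Ω → RoundAlgorithm U)
    (s : ℕ) (Q : ℝ) : Prop where
  queries_le : ∀ M₁ M₂ : Matroid U, IsNestedMatroid M₁ → IsNestedMatroid M₂ →
    ∀ ω, ∀ k < s, (((A ω).roundQueries M₁ M₂ k).card : ℝ) ≤ Q
  measurable_result : ∀ M₁ M₂ : Matroid U, IsNestedMatroid M₁ → IsNestedMatroid M₂ →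
    Measurable fun ω => (A ω).result M₁ M₂ s
  success : ∀ M₁ M₂ : Matroid U, IsNestedMatroid M₁ → IsNestedMatroid M₂ →
    2 / 3 ≤ P.real {ω | (A ω).result M₁ M₂ s = matroidIntersectionValue M₁ M₂}

/-! A uniformly random permutation places the blocks `0, …, 2 * m`, of which the first `2 * m`
shrink slowly and the last, of size `w`, is huge. The proper constraints of the first matroid
concern suffixes that start at an odd block, those of the second prefixes that end at an odd block.
For `d = 0` the capacities are those used by all even blocks below `2 * m` together with half of the
last block, so this set is optimal; for `d = 1` a single prefix capacity drops by one and the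
optimum falls (`matroidIntersectionValue_lt`, `le_matroidIntersectionValue`).

A rank is a minimum over the constraints. Suppose `S` meets all blocks from `k` on in nearly the
same proportion `z`. Pairing each even block with the larger odd block before it shows that between
two suffix constraints the capacity grows by slightly less than half of the size; pairing it with
the smaller odd block after it gives slightly more than half for prefixes. If `z` is large, a late
suffix constraint is no stronger than an earlier one; otherwise `z` is below `1/2` by order `1/m`,
and the huge last block makes it weaker than the bound `|S|`. For prefixes the directions are
reversed, and the constraint on the whole universe replaces `|S|` (`suffix_hidden`,
`prefix_hidden`). Hence answers to balanced queries in round `k` depend only on the blocks up to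
`k`, and the lowered capacity stays invisible in the rounds before `2 * m - 1`, counted from `0`.

Given the blocks below `k`, the others are still uniformly distributed. A hypergeometric tail bound
(`card_perm_two_sided_tail_le`) makes a fixed query unbalanced with probability at most `O(m) * exp
(-Ω(h / m))`, and a union bound covers all queries and rounds. With `m` of order `(N / (c log N)) ^
(1/3)` and `h` of order `N / m ^ 2`, the ratio `h / m` is a large multiple of `c log N`, which beats
the `N ^ c` queries per round. -/

/-! ### The rank function of a nested matroid -/

/-- The rank of `S` in a nested matroid is the minimum of `|S|` and the numbers
`cap t + |S \ C t|`. -/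
theorem le_nestedMatroid_rank_iff {U : Type*} [DecidableEq U] {m : ℕ}
    (C : Fin (m + 1) → Finset U) (hC : Antitone C) (cap : Fin (m + 1) → ℕ) (S : Finset U) (c : ℕ) :
    c ≤ ((nestedMatroid C hC cap).eRk (S : Set U)).toNat ↔
      c ≤ S.card ∧ ∀ t, c ≤ cap t + (S \ C t).card := by
  classical
  obtain ⟨I', hI'⟩ := (nestedMatroid C hC cap).exists_isBasis' (S : Set U)
  obtain ⟨I, rfl⟩ : ∃ I : Finset U, (I : Set U) = I' :=
    ⟨(S.finite_toSet.subset hI'.subset).toFinset, by simp⟩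
  have hIS : I ⊆ S := by exact_mod_cast hI'.subset
  have hind := (nestedMatroid_indep_iff C hC cap I).1 hI'.indep
  rw [hI'.eRk_eq_encard, Set.encard_coe_eq_coe_finsetCard, ENat.toNat_natCast]
  constructor
  · intro hc
    refine ⟨hc.trans (Finset.card_le_card hIS), fun t => hc.trans ?_⟩
    have h1 := Finset.card_inter_add_card_sdiff I (C t)
    have h2 : (I \ C t).card ≤ (S \ C t).card :=
      Finset.card_le_card (Finset.sdiff_subset_sdiff hIS le_rfl)
    have h3 := hind t
    omega
  · rintro ⟨hcS, hc⟩
    by_cases hSI : S ⊆ I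
    · exact hcS.trans (Finset.card_le_card hSI)
    -- By maximality of `I`, every rejected element lies in a tight set. The outermost tight set
    -- contains all of them, so outside it `I` and `S` agree.
    have htight : ∀ e ∈ S, e ∉ I → ∃ t, e ∈ C t ∧ cap t ≤ (I ∩ C t).card := by
      intro e heS heI
      have hdep := hI'.insert_not_indep (e := e) ⟨by exact_mod_cast heS, by exact_mod_cast heI⟩
      rw [← Finset.coe_insert, nestedMatroid_indep_iff] at hdep
      push Not at hdep
      obtain ⟨t, ht⟩ := hdep
      have het : e ∈ C t := by
        by_contra het
        rw [Finset.insert_inter_of_notMem het] at ht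
        exact absurd (hind t) (not_le.2 ht)
      refine ⟨t, het, ?_⟩
      rw [Finset.insert_inter_of_mem het] at ht
      have := Finset.card_insert_le e (I ∩ C t)
      omega
    let T : Finset (Fin (m + 1)) := Finset.univ.filter fun t => cap t ≤ (I ∩ C t).card
    obtain ⟨e₀, he₀S, he₀I⟩ := Finset.not_subset.1 hSI
    obtain ⟨t₁, -, ht₁⟩ := htight e₀ he₀S he₀I
    have hT : T.Nonempty := ⟨t₁, Finset.mem_filter.2 ⟨Finset.mem_univ _, ht₁⟩⟩
    have ht₀ : cap (T.min' hT) ≤ (I ∩ C (T.min' hT)).card :=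
      (Finset.mem_filter.1 (T.min'_mem hT)).2
    have hsub : S \ C (T.min' hT) ⊆ I \ C (T.min' hT) := by
      intro e he
      rw [Finset.mem_sdiff] at he ⊢
      refine ⟨?_, he.2⟩
      by_contra heI
      obtain ⟨t, het, ht⟩ := htight e he.1 heI
      exact he.2 (hC (T.min'_le t (Finset.mem_filter.2 ⟨Finset.mem_univ _, ht⟩)) het)
    have h1 := Finset.card_inter_add_card_sdiff I (C (T.min' hT))
    have h2 := Finset.card_le_card hsub
    have h3 := hc (T.min' hT)
    omega

/-! ### The hard instances -/

/-- The sizes of the blocks `0, …, 2 * m` of a staircase labelling: the first `2 * m` blocks shrink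
by `h` from one to the next, and the last block has size `w`. -/
def blockSize (m h w i : ℕ) : ℕ := if i < 2 * m then h * (4 * m - 2 - i) else w

/-- `ℓ` labels the elements of the universe with the blocks `0, …, 2 * m`. -/
structure IsStaircase {U : Type*} [Fintype U] (m h w : ℕ) (ℓ : U → ℕ) : Prop where
  le : ∀ u, ℓ u ≤ 2 * m
  card_eq : ∀ i ≤ 2 * m, (Finset.univ.filter fun u => ℓ u = i).card = blockSize m h w i

/-- The total size of the even blocks with index in `[2 * a, 2 * b)`. -/
def evenSize (m h w a b : ℕ) : ℕ := ∑ i ∈ Finset.Ico a b, blockSize m h w (2 * i)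

/-- The capacity of the union of the blocks with index at least `2 * t - 1`. -/
def suffixCap (m h w t : ℕ) : ℕ := evenSize m h w t m + w / 2

/-- The capacity of the union of the blocks with index less than `2 * j`; the parameter `d` lowers
the capacity for `j = m`. -/
def prefixCap (m h w d j : ℕ) : ℕ :=
  if j < m then evenSize m h w 0 j
  else if j = m then evenSize m h w 0 m - d else evenSize m h w 0 m + w / 2

theorem antitone_suffixes {U : Type*} [Fintype U] (m : ℕ) (ℓ : U → ℕ) :
    Antitone fun t : Fin (m + 1) => Finset.univ.filter fun u => 2 * (t : ℕ) ≤ ℓ u + 1 :=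
  fun s t hst => Finset.monotone_filter_right _ fun u _ hu => by
    have : (s : ℕ) ≤ t := hst
    omega

theorem antitone_prefixes {U : Type*} [Fintype U] (m : ℕ) (ℓ : U → ℕ) :
    Antitone fun t : Fin (m + 1) => Finset.univ.filter fun u => ℓ u < 2 * (m + 1 - (t : ℕ)) :=
  fun s t hst => Finset.monotone_filter_right _ fun u _ hu => by
    have : (s : ℕ) ≤ t := hst
    omega

section Matroids

variable {U : Type*} [Fintype U] [DecidableEq U]

/-- The nested matroid given by the suffixes of the sequence of blocks. -/
def suffixMatroid (m h w : ℕ) (ℓ : U → ℕ) : Matroid U :=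
  nestedMatroid (m := m) (fun t => Finset.univ.filter fun u => 2 * (t : ℕ) ≤ ℓ u + 1)
    (antitone_suffixes m ℓ) (fun t => suffixCap m h w t)

/-- The nested matroid given by the prefixes of the sequence of blocks. -/
def prefixMatroid (m h w d : ℕ) (ℓ : U → ℕ) : Matroid U :=
  nestedMatroid (m := m) (fun t => Finset.univ.filter fun u => ℓ u < 2 * (m + 1 - (t : ℕ)))
    (antitone_prefixes m ℓ) (fun t => prefixCap m h w d (m + 1 - (t : ℕ)))

theorem isNestedMatroid_suffixMatroid (m h w : ℕ) (ℓ : U → ℕ) :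
    IsNestedMatroid (suffixMatroid m h w ℓ) :=
  ⟨_, _, _, _, by ext; simp, rfl⟩

theorem isNestedMatroid_prefixMatroid {m h w : ℕ} (d : ℕ) {ℓ : U → ℕ} (hℓ : IsStaircase m h w ℓ) :
    IsNestedMatroid (prefixMatroid m h w d ℓ) :=
  ⟨_, _, _, _, by
    ext u
    have := hℓ.le u
    simp
    omega, rfl⟩

theorem le_suffixMatroid_rank_iff (m h w : ℕ) (ℓ : U → ℕ) (S : Finset U) (c : ℕ) :
    c ≤ ((suffixMatroid m h w ℓ).eRk (S : Set U)).toNat ↔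
      c ≤ S.card ∧ ∀ t ≤ m, c ≤ suffixCap m h w t + (S.filter fun u => ℓ u + 1 < 2 * t).card := by
  rw [suffixMatroid, le_nestedMatroid_rank_iff, Fin.forall_iff]
  refine and_congr_right fun _ => ⟨fun H t ht => ?_, fun H t ht => ?_⟩
  · convert H t (by omega) using 3
    ext u
    simp
  · convert H t (by omega) using 3
    ext u
    simp

theorem le_prefixMatroid_rank_iff (m h w d : ℕ) (ℓ : U → ℕ) (S : Finset U) (c : ℕ) :
    c ≤ ((prefixMatroid m h w d ℓ).eRk (S : Set U)).toNat ↔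
      c ≤ S.card ∧ ∀ j, 1 ≤ j → j ≤ m + 1 →
        c ≤ prefixCap m h w d j + (S.filter fun u => 2 * j ≤ ℓ u).card := by
  rw [prefixMatroid, le_nestedMatroid_rank_iff, Fin.forall_iff]
  refine and_congr_right fun _ => ⟨fun H j hj1 hjm => ?_, fun H t ht => ?_⟩
  · convert H (m + 1 - j) (by omega) using 3
    · simp only
      omega
    · ext u
      simp
      intro _
      omega
  · convert H (m + 1 - t) (by omega) (by omega) using 3
    ext u
    simp

theorem suffixMatroid_indep_iff (m h w : ℕ) (ℓ : U → ℕ) (I : Finset U) :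
    (suffixMatroid m h w ℓ).Indep (I : Set U) ↔
      ∀ t ≤ m, (I.filter fun u => 2 * t ≤ ℓ u + 1).card ≤ suffixCap m h w t := by
  rw [suffixMatroid, nestedMatroid_indep_iff, Fin.forall_iff]
  refine ⟨fun H t ht => ?_, fun H t ht => ?_⟩
  · convert H t (by omega) using 2
    ext u
    simp
  · convert H t (by omega) using 2
    ext u
    simp

theorem prefixMatroid_indep_iff (m h w d : ℕ) (ℓ : U → ℕ) (I : Finset U) :
    (prefixMatroid m h w d ℓ).Indep (I : Set U) ↔
      ∀ j, 1 ≤ j → j ≤ m + 1 →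
        (I.filter fun u => ℓ u < 2 * j).card ≤ prefixCap m h w d j := by
  rw [prefixMatroid, nestedMatroid_indep_iff, Fin.forall_iff]
  refine ⟨fun H j hj1 hjm => ?_, fun H t ht => ?_⟩
  · convert H (m + 1 - j) (by omega) using 2
    · ext u
      simp
      intro _
      omega
    · simp only
      omega
  · convert H (m + 1 - t) (by omega) (by omega) using 2
    ext u
    simp

/-! ### The optimum of the hard instances -/

/-- The lowered prefix constraint bounds the part below block `2 * m`, and the innermost suffix
constraint bounds the rest by `w / 2`. Positivity of `evenSize` keeps the natural subtraction of `d
= 1` from truncating. -/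
theorem matroidIntersectionValue_lt {m h w : ℕ} (hm : 1 ≤ m) (hh : 1 ≤ h) (ℓ : U → ℕ) :
    matroidIntersectionValue (suffixMatroid m h w ℓ) (prefixMatroid m h w 1 ℓ) <
      evenSize m h w 0 m + w / 2 := by
  classical
  have hpos : 1 ≤ evenSize m h w 0 m := by
    rw [evenSize, Finset.sum_eq_sum_Ico_succ_bot (by omega)]
    have : 0 < h * (4 * m - 2) := Nat.mul_pos hh (by omega)
    simp only [blockSize]
    rw [if_pos (by omega)]
    simp only [mul_zero, Nat.sub_zero]
    omega
  refine (Finset.sup_lt_iff (by simp only [Nat.bot_eq_zero]; omega)).2 fun I hI => ?_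
  obtain ⟨h1, h2⟩ := (Finset.mem_filter.1 hI).2
  have h1' := (suffixMatroid_indep_iff m h w ℓ I).1 h1 m le_rfl
  have h2' := (prefixMatroid_indep_iff m h w 1 ℓ I).1 h2 m hm (by omega)
  rw [suffixCap, evenSize, Finset.Ico_self, Finset.sum_empty] at h1'
  rw [prefixCap, if_neg (lt_irrefl m), if_pos rfl] at h2'
  have hsplit := Finset.card_filter_add_card_filter_not (s := I) fun u => ℓ u < 2 * m
  have hle : (I.filter fun u => ¬ ℓ u < 2 * m).card ≤
      (I.filter fun u => 2 * m ≤ ℓ u + 1).card :=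
    Finset.card_le_card (Finset.monotone_filter_right _ fun u _ hu => by omega)
  omega

/-- The witness consists of all even blocks below `2 * m` and any `w / 2` elements of the last
block. -/
theorem le_matroidIntersectionValue {m h w : ℕ} {ℓ : U → ℕ} (hℓ : IsStaircase m h w ℓ) :
    evenSize m h w 0 m + w / 2 ≤
      matroidIntersectionValue (suffixMatroid m h w ℓ) (prefixMatroid m h w 0 ℓ) := by
  classical
  obtain ⟨R, hR, hRc⟩ : ∃ R ⊆ Finset.univ.filter (fun u => ℓ u = 2 * m), R.card = w / 2 := by
    refine Finset.exists_subset_card_eq ?_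
    rw [hℓ.card_eq _ le_rfl, blockSize, if_neg (lt_irrefl _)]
    omega
  have hRℓ : ∀ u ∈ R, ℓ u = 2 * m := fun u hu => (Finset.mem_filter.1 (hR hu)).2
  have heven : ∀ a b, b ≤ m →
      (Finset.univ.filter fun u => ℓ u % 2 = 0 ∧ 2 * a ≤ ℓ u ∧ ℓ u < 2 * b).card =
        evenSize m h w a b := by
    intro a b hb
    rw [Finset.card_eq_sum_card_fiberwise (f := fun u => ℓ u / 2) (t := Finset.Ico a b), evenSize]
    · refine Finset.sum_congr rfl fun i hi => ?_
      rw [Finset.mem_Ico] at hi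
      rw [← hℓ.card_eq (2 * i) (by omega), Finset.filter_filter]
      congr 1
      ext u
      simp only [Finset.mem_filter, Finset.mem_univ, true_and]
      omega
    · intro u hu
      simp only [Finset.coe_filter, Finset.mem_univ, true_and, Set.mem_ofPred_eq,
        Finset.coe_Ico, Set.mem_Ico] at hu ⊢
      omega
  set E := Finset.univ.filter fun u => ℓ u % 2 = 0 ∧ 2 * 0 ≤ ℓ u ∧ ℓ u < 2 * m with hE
  have hdisj : Disjoint E R := by
    rw [Finset.disjoint_left]
    intro u hu hu'
    have h1 := (Finset.mem_filter.1 hu).2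
    have h2 := hRℓ u hu'
    omega
  have hcard : (E ∪ R).card = evenSize m h w 0 m + w / 2 := by
    rw [Finset.card_union_of_disjoint hdisj, heven 0 m le_rfl, hRc]
  rw [← hcard]
  refine Finset.le_sup (f := Finset.card) (Finset.mem_filter.2 ⟨Finset.mem_univ _, ?_, ?_⟩)
  · rw [suffixMatroid_indep_iff]
    intro t ht
    rw [Finset.filter_union, suffixCap]
    refine (Finset.card_union_le _ _).trans (add_le_add ?_ ?_)
    · rw [← heven t m le_rfl]
      refine Finset.card_le_card fun u hu => ?_
      simp only [hE, Finset.mem_filter, Finset.mem_univ, true_and] at hu ⊢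
      omega
    · rw [← hRc]
      exact Finset.card_filter_le _ _
  · rw [prefixMatroid_indep_iff]
    intro j hj1 hjm
    rcases Nat.lt_or_ge m j with hj | hj
    · rw [prefixCap, if_neg (by omega), if_neg (by omega), ← hcard]
      exact Finset.card_filter_le _ _
    · have hcap : prefixCap m h w 0 j = evenSize m h w 0 j := by
        rw [prefixCap]
        split_ifs with h1 h2
        · rfl
        · rw [h2, Nat.sub_zero]
        · omega
      rw [hcap, ← heven 0 j hj]
      refine Finset.card_le_card fun u hu => ?_
      simp only [hE, Finset.mem_filter, Finset.mem_union, Finset.mem_univ, true_and] at hu ⊢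
      rcases hu with ⟨hu | hu, hu'⟩
      · omega
      · have := hRℓ u hu
        omega

end Matroids

/-! ### Tail bounds for random permutations -/

section Tail

variable {V : Type*} [Fintype V] [DecidableEq V]

/-- The number of permutations mapping `insert e I` into `T` does not depend on `e ∉ I`. -/
theorem card_perm_insert_eq (T I : Finset V) {e e' : V} (he : e ∉ I) (he' : e' ∉ I) :
    (Finset.univ.filter fun τ : Equiv.Perm V => ∀ x ∈ insert e I, τ x ∈ T).card =
      (Finset.univ.filter fun τ : Equiv.Perm V => ∀ x ∈ insert e' I, τ x ∈ T).card := by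
  refine Finset.card_equiv (Equiv.mulRight (Equiv.swap e e')) fun τ => ?_
  have hfix : ∀ x ∈ I, Equiv.swap e e' x = x := fun x hx =>
    Equiv.swap_apply_of_ne_of_ne (fun h => he (h ▸ hx)) (fun h => he' (h ▸ hx))
  simp only [Finset.mem_filter, Finset.mem_univ, true_and, Finset.forall_mem_insert,
    Equiv.coe_mulRight, Equiv.Perm.coe_mul, Function.comp_apply, Equiv.swap_apply_right]
  refine and_congr_right fun _ => forall₂_congr fun x hx => ?_
  rw [hfix x hx]

/-- Double counting of pairs `(e', τ)` with `e' ∉ I` and `τ` mapping `insert e' I` into `T`; all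
`e'` contribute equally. This is one step of sampling without replacement. -/
theorem card_perm_insert_mul (T I : Finset V) {e : V} (he : e ∉ I) :
    (Finset.univ.filter fun τ : Equiv.Perm V => ∀ x ∈ insert e I, τ x ∈ T).card *
        (Fintype.card V - I.card) =
      (Finset.univ.filter fun τ : Equiv.Perm V => ∀ x ∈ I, τ x ∈ T).card *
        (T.card - I.card) := by
  have hcount : ∀ τ : Equiv.Perm V, (∀ x ∈ I, τ x ∈ T) →
      (Finset.univ.filter fun y => y ∉ I ∧ τ y ∈ T).card = T.card - I.card := by
    intro τ hτ
    have h1 : (Finset.univ.filter fun y => y ∉ I ∧ τ y ∈ T) = T.map τ.symm.toEmbedding \ I := by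
      ext y
      simp [and_comm]
    rw [h1, Finset.card_sdiff_of_subset, Finset.card_map]
    intro x hx
    simpa using hτ x hx
  have hswap : ∑ e' ∈ Iᶜ,
      (Finset.univ.filter fun τ : Equiv.Perm V => ∀ x ∈ insert e' I, τ x ∈ T).card =
      ∑ τ ∈ Finset.univ.filter (fun τ : Equiv.Perm V => ∀ x ∈ I, τ x ∈ T),
        (Finset.univ.filter fun y => y ∉ I ∧ τ y ∈ T).card := by
    simp only [Finset.card_eq_sum_ones, Finset.sum_filter]
    rw [Finset.sum_comm]
    refine Finset.sum_congr rfl fun τ _ => ?_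
    rw [← Finset.sum_filter, ← Finset.sum_filter]
    split_ifs with h
    · rw [← Finset.card_eq_sum_ones, ← Finset.card_eq_sum_ones]
      congr 1
      ext y
      simp only [Finset.mem_filter, Finset.mem_compl, Finset.mem_univ, true_and,
        Finset.forall_mem_insert]
      tauto
    · rw [← Finset.card_eq_sum_ones, Finset.card_eq_zero, Finset.filter_eq_empty_iff]
      intro y _ hy
      exact h fun x hx => hy x (Finset.mem_insert_of_mem hx)
  rw [Finset.sum_congr rfl fun e' he' => card_perm_insert_eq T I (Finset.mem_compl.1 he') he,
    Finset.sum_const, Finset.card_compl, smul_eq_mul] at hswap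
  rw [mul_comm, hswap, Finset.sum_congr rfl fun τ hτ => hcount τ (Finset.mem_filter.1 hτ).2,
    Finset.sum_const, smul_eq_mul]

/-- A random permutation maps `I` into `T` with probability at most `(|T| / |V|) ^ |I|`. -/
theorem card_perm_mapsTo_le (T I : Finset V) :
    ((Finset.univ.filter fun τ : Equiv.Perm V => ∀ x ∈ I, τ x ∈ T).card : ℝ) ≤
      ((T.card : ℝ) / Fintype.card V) ^ I.card * (Fintype.card V).factorial := by
  induction I using Finset.induction_on with
  | empty => simp [Fintype.card_perm]
  | insert e I he ih =>
    rw [Finset.card_insert_of_notMem he, pow_succ]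
    set a := (Finset.univ.filter fun τ : Equiv.Perm V => ∀ x ∈ insert e I, τ x ∈ T).card
    set b := (Finset.univ.filter fun τ : Equiv.Perm V => ∀ x ∈ I, τ x ∈ T).card
    have hmul : a * (Fintype.card V - I.card) = b * (T.card - I.card) :=
      card_perm_insert_mul T I he
    have hIV : I.card < Fintype.card V := Finset.card_lt_univ_of_notMem he
    have hTV : T.card ≤ Fintype.card V := Finset.card_le_univ T
    have hVpos : (0 : ℝ) < Fintype.card V := by exact_mod_cast (Nat.zero_le _).trans_lt hIV
    have hab : (a : ℝ) ≤ b * ((T.card : ℝ) / Fintype.card V) := by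
      rw [← mul_div_assoc, le_div_iff₀ hVpos]
      rcases le_total T.card I.card with hTI | hTI
      · rw [Nat.sub_eq_zero_of_le hTI, mul_zero] at hmul
        have ha : a = 0 := (Nat.mul_eq_zero.1 hmul).resolve_right (by omega)
        rw [ha]
        push_cast
        rw [zero_mul]
        positivity
      · obtain ⟨p, hp⟩ := Nat.exists_eq_add_of_le hTI
        obtain ⟨q, hq⟩ := Nat.exists_eq_add_of_le hIV.le
        have hp' : T.card - I.card = p := by omega
        have hq' : Fintype.card V - I.card = q := by omega
        rw [hp', hq'] at hmul
        have hqpos : 0 < q := by omega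
        have hpq : p ≤ q := by omega
        have key : a * Fintype.card V ≤ b * T.card := by
          have hab' : a ≤ b := by
            by_contra hlt
            push Not at hlt
            have h1 : b * q < a * q := Nat.mul_lt_mul_of_pos_right hlt hqpos
            have h2 : b * p ≤ b * q := Nat.mul_le_mul_left b hpq
            omega
          rw [hp, hq, mul_add, mul_add, hmul]
          exact Nat.add_le_add_right (Nat.mul_le_mul_right _ hab') _
        exact_mod_cast key
    calc (a : ℝ) ≤ b * ((T.card : ℝ) / Fintype.card V) := hab
      _ ≤ (((T.card : ℝ) / Fintype.card V) ^ I.card * (Fintype.card V).factorial) *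
          ((T.card : ℝ) / Fintype.card V) := by gcongr
      _ = _ := by ring

/-- The moment generating function of the hypergeometric distribution is at most that of the
binomial distribution. -/
theorem sum_perm_pow_le (T B : Finset V) {t : ℝ} (ht : 0 ≤ t) :
    ∑ τ : Equiv.Perm V, (1 + t) ^ (B.filter fun x => τ x ∈ T).card ≤
      (1 + (T.card : ℝ) / Fintype.card V * t) ^ B.card * (Fintype.card V).factorial := by
  -- Binomial expansion over the subsets of `B` that `τ` maps into `T`, so that the bound for each
  -- subset applies after exchanging sums.
  have hexp : ∀ τ : Equiv.Perm V, (1 + t) ^ (B.filter fun x => τ x ∈ T).card =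
      ∑ I ∈ B.powerset, if ∀ x ∈ I, τ x ∈ T then t ^ I.card else 0 := by
    intro τ
    rw [add_comm, ← Finset.sum_pow_mul_eq_add_pow, ← Finset.sum_filter]
    refine Finset.sum_congr ?_ fun I _ => by rw [one_pow, mul_one]
    ext I
    simp only [Finset.mem_powerset, Finset.mem_filter, Finset.subset_iff]
    grind
  simp_rw [hexp]
  rw [Finset.sum_comm]
  calc ∑ I ∈ B.powerset, ∑ τ : Equiv.Perm V, (if ∀ x ∈ I, τ x ∈ T then t ^ I.card else 0)
      = ∑ I ∈ B.powerset,
        ((Finset.univ.filter fun τ : Equiv.Perm V => ∀ x ∈ I, τ x ∈ T).card : ℝ) * t ^ I.card := by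
        refine Finset.sum_congr rfl fun I _ => ?_
        rw [← Finset.sum_filter, Finset.sum_const, nsmul_eq_mul]
    _ ≤ ∑ I ∈ B.powerset,
        (((T.card : ℝ) / Fintype.card V) ^ I.card * (Fintype.card V).factorial) * t ^ I.card := by
        gcongr with I _
        exact card_perm_mapsTo_le T I
    _ = ∑ I ∈ B.powerset, (((T.card : ℝ) / Fintype.card V * t) ^ I.card * 1 ^ (B.card - I.card)) *
          (Fintype.card V).factorial := by
        refine Finset.sum_congr rfl fun I _ => ?_
        rw [one_pow, mul_one, mul_pow]
        ring
    _ = _ := by rw [← Finset.sum_mul, Finset.sum_pow_mul_eq_add_pow, add_comm]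

/-- Chernoff's method: the choice `l = γ / 2` minimizes the exponent `l ^ 2 - l * γ`, and `γ ≤ 2`
gives `l ≤ 1`, needed for `exp l - 1 ≤ l + l ^ 2`. -/
theorem card_perm_upper_tail_le (T B : Finset V) {γ : ℝ} (hγ : 0 ≤ γ) (hγ2 : γ ≤ 2) :
    ((Finset.univ.filter fun τ : Equiv.Perm V =>
        ((T.card : ℝ) / Fintype.card V + γ) * B.card < (B.filter fun x => τ x ∈ T).card).card : ℝ) ≤
      Real.exp (-(γ ^ 2 * B.card / 4)) * (Fintype.card V).factorial := by
  set z : ℝ := (T.card : ℝ) / Fintype.card V with hz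
  have hz0 : 0 ≤ z := by positivity
  have hz1 : z ≤ 1 := div_le_one_of_le₀ (by exact_mod_cast Finset.card_le_univ T) (by positivity)
  set l : ℝ := γ / 2 with hl
  have hl0 : 0 ≤ l := by positivity
  have hl1 : l ≤ 1 := by linarith
  have hexp : Real.exp l - 1 ≤ l + l ^ 2 := by
    have := Real.abs_exp_sub_one_sub_id_le (x := l) (by rw [abs_of_nonneg hl0]; exact hl1)
    linarith [(abs_le.1 this).2]
  have ht : 0 ≤ Real.exp l - 1 := by linarith [Real.add_one_le_exp l]
  have hmgf := sum_perm_pow_le T B ht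
  set bad := Finset.univ.filter fun τ : Equiv.Perm V =>
    (z + γ) * B.card < (B.filter fun x => τ x ∈ T).card with hbad
  have hlow : (bad.card : ℝ) * Real.exp (l * ((z + γ) * B.card)) ≤
      ∑ τ : Equiv.Perm V, (1 + (Real.exp l - 1)) ^ (B.filter fun x => τ x ∈ T).card := by
    rw [← nsmul_eq_mul, ← Finset.sum_const]
    refine (Finset.sum_le_sum fun τ hτ => ?_).trans
      (Finset.sum_le_sum_of_subset_of_nonneg (Finset.subset_univ bad) fun τ _ _ => by positivity)
    rw [add_sub_cancel, ← Real.exp_nat_mul, mul_comm]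
    have := (Finset.mem_filter.1 hτ).2
    gcongr
  have hup : (1 + z * (Real.exp l - 1)) ^ B.card ≤ Real.exp (B.card * (z * l + l ^ 2)) := by
    rw [Real.exp_nat_mul]
    gcongr
    have h1 : z * (Real.exp l - 1) ≤ z * l + l ^ 2 := by nlinarith [sq_nonneg l]
    linarith [Real.add_one_le_exp (z * l + l ^ 2)]
  have hpos := Real.exp_pos (l * ((z + γ) * B.card))
  have hfin : Real.exp (B.card * (z * l + l ^ 2)) =
      Real.exp (-(γ ^ 2 * B.card / 4)) * Real.exp (l * ((z + γ) * B.card)) := by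
    rw [← Real.exp_add]
    congr 1
    rw [hl]
    ring
  refine le_of_mul_le_mul_right ?_ hpos
  calc _ ≤ (1 + z * (Real.exp l - 1)) ^ B.card * (Fintype.card V).factorial := hlow.trans hmgf
    _ ≤ (Real.exp (-(γ ^ 2 * B.card / 4)) * Real.exp (l * ((z + γ) * B.card))) *
        (Fintype.card V).factorial := by rw [← hfin]; gcongr
    _ = _ := by ring

/-- For a random permutation, the share of `B` mapped into `T` is close to the share of `T`. -/
theorem card_perm_two_sided_tail_le (T B : Finset V) {γ : ℝ} (hγ : 0 ≤ γ) (hγ2 : γ ≤ 2) :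
    ((Finset.univ.filter fun τ : Equiv.Perm V =>
        γ * B.card < |((B.filter fun x => τ x ∈ T).card : ℝ) -
          (T.card : ℝ) / Fintype.card V * B.card|).card : ℝ) ≤
      2 * Real.exp (-(γ ^ 2 * B.card / 4)) * (Fintype.card V).factorial := by
  classical
  have h1 := card_perm_upper_tail_le T B hγ hγ2
  have h2 := card_perm_upper_tail_le Tᶜ B hγ hγ2
  have hsub : (Finset.univ.filter fun τ : Equiv.Perm V =>
        γ * B.card < |((B.filter fun x => τ x ∈ T).card : ℝ) -
          (T.card : ℝ) / Fintype.card V * B.card|) ⊆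
      (Finset.univ.filter fun τ : Equiv.Perm V =>
        ((T.card : ℝ) / Fintype.card V + γ) * B.card < (B.filter fun x => τ x ∈ T).card) ∪
      (Finset.univ.filter fun τ : Equiv.Perm V =>
        ((Tᶜ.card : ℝ) / Fintype.card V + γ) * B.card < (B.filter fun x => τ x ∈ Tᶜ).card) := by
    intro τ hτ
    simp only [Finset.mem_filter, Finset.mem_univ, true_and, Finset.mem_union] at hτ ⊢
    rcases lt_abs.1 hτ with h | h
    · left
      linarith
    · right
      rcases isEmpty_or_nonempty V with hV | hV
      · have hB : B = ∅ := Finset.eq_empty_of_isEmpty B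
        simp [hB] at h
      have hVpos : (0 : ℝ) < Fintype.card V := by exact_mod_cast Fintype.card_pos
      have hc : ((Tᶜ.card : ℝ)) / Fintype.card V = 1 - (T.card : ℝ) / Fintype.card V := by
        rw [Finset.card_compl, Nat.cast_sub (Finset.card_le_univ T), sub_div, div_self hVpos.ne']
      have hs : ((B.filter fun x => τ x ∈ T).card : ℝ) + (B.filter fun x => τ x ∈ Tᶜ).card =
          B.card := by
        simp only [Finset.mem_compl]
        exact_mod_cast Finset.card_filter_add_card_filter_not (s := B) fun x => τ x ∈ T
      rw [hc]
      linarith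
  have h3 : (_ : ℝ) ≤ _ :=
    Nat.cast_le.2 ((Finset.card_le_card hsub).trans (Finset.card_union_le _ _))
  rw [Nat.cast_add] at h3
  linarith

end Tail

/-! ### Hidden constraints -/

/-- The blocks with index at least `k` meet `S` in nearly equal proportions. -/
def IsBalanced {U : Type*} (m h w : ℕ) (ℓ : U → ℕ) (k : ℕ) (S : Finset U) : Prop :=
  ∃ z : ℝ, ∀ i, k ≤ i → i ≤ 2 * m →
    |((S.filter fun u => ℓ u = i).card : ℝ) - z * blockSize m h w i| ≤
      1 / (128 * m) * blockSize m h w i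

theorem abs_card_filter_interval_sub_le {U : Type*} {m h w : ℕ} {ℓ : U → ℕ} {k : ℕ} {S : Finset U}
    {z : ℝ} (hz : ∀ i, k ≤ i → i ≤ 2 * m →
      |((S.filter fun u => ℓ u = i).card : ℝ) - z * blockSize m h w i| ≤
        1 / (128 * m) * blockSize m h w i) {a b : ℕ} (ha : k ≤ a) (hb : b ≤ 2 * m + 1) :
    |((S.filter fun u => a ≤ ℓ u ∧ ℓ u < b).card : ℝ) -
        z * ((∑ i ∈ Finset.Ico a b, blockSize m h w i : ℕ) : ℝ)| ≤
      1 / (128 * m) * ((∑ i ∈ Finset.Ico a b, blockSize m h w i : ℕ) : ℝ) := by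
  have hcard : (S.filter fun u => a ≤ ℓ u ∧ ℓ u < b).card =
      ∑ i ∈ Finset.Ico a b, (S.filter fun u => ℓ u = i).card := by
    rw [Finset.card_eq_sum_card_fiberwise (f := ℓ) (t := Finset.Ico a b)]
    · refine Finset.sum_congr rfl fun i hi => ?_
      rw [Finset.mem_Ico] at hi
      rw [Finset.filter_filter]
      congr 1
      ext u
      simp only [Finset.mem_filter]
      refine and_congr_right fun _ => ?_
      omega
    · intro u hu
      have := (Finset.mem_filter.1 (Finset.mem_coe.1 hu)).2
      simpa using this
  rw [hcard]
  push_cast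
  rw [Finset.mul_sum, Finset.mul_sum, ← Finset.sum_sub_distrib]
  refine (Finset.abs_sum_le_sum_abs _ _).trans (Finset.sum_le_sum fun i hi => ?_)
  rw [Finset.mem_Ico] at hi
  exact hz i (by omega) (by omega)

/-! ### Sums of block sizes. -/

theorem evenSize_add {m h w a b c : ℕ} (hab : a ≤ b) (hbc : b ≤ c) :
    evenSize m h w a b + evenSize m h w b c = evenSize m h w a c :=
  Finset.sum_Ico_consecutive _ hab hbc

/-- The total size of the blocks with index in `[2 * a + 1, 2 * b + 1)`. -/
theorem sum_blockSize_odd_interval {m h w a b : ℕ} (hab : a ≤ b) (hbm : b < m) :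
    ∑ i ∈ Finset.Ico (2 * a + 1) (2 * b + 1), blockSize m h w i =
      2 * evenSize m h w (a + 1) (b + 1) + h * (b - a) := by
  induction b, hab using Nat.le_induction with
  | base => simp [evenSize]
  | succ b hab ih =>
    rw [evenSize, Finset.sum_Ico_succ_top (by omega : a + 1 ≤ b + 1), ← evenSize,
      show 2 * (b + 1) = 2 * b + 1 + 1 by ring, Finset.sum_Ico_succ_top (by omega),
      Finset.sum_Ico_succ_top (by omega), ih (by omega), blockSize, blockSize,
      if_pos (by omega), if_pos (by omega), show b + 1 - a = b - a + 1 by omega,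
      show 4 * m - 2 - (2 * b + 1) = 4 * m - 2 - (2 * b + 1 + 1) + 1 by omega]
    ring

/-- The total size of the blocks with index in `[2 * a, 2 * b)`. -/
theorem sum_blockSize_even_interval {m h w a b : ℕ} (hab : a ≤ b) (hbm : b ≤ m) :
    ∑ i ∈ Finset.Ico (2 * a) (2 * b), blockSize m h w i + h * (b - a) =
      2 * evenSize m h w a b := by
  induction b, hab using Nat.le_induction with
  | base => simp [evenSize]
  | succ b hab ih =>
    have := ih (by omega)
    rw [evenSize, Finset.sum_Ico_succ_top hab, ← evenSize,
      mul_add 2 (evenSize m h w a b), ← this, show 2 * (b + 1) = 2 * b + 1 + 1 by ring,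
      Finset.sum_Ico_succ_top (by omega),
      Finset.sum_Ico_succ_top (by omega), blockSize, blockSize,
      if_pos (by omega), if_pos (by omega), show b + 1 - a = b - a + 1 by omega,
      show 4 * m - 2 - 2 * b = 4 * m - 2 - (2 * b + 1) + 1 by omega]
    ring

theorem sum_blockSize_le {m h w a b : ℕ} (hbm : b ≤ 2 * m) :
    ∑ i ∈ Finset.Ico a b, blockSize m h w i ≤ 4 * m * h * (b - a) := by
  calc _ ≤ ∑ i ∈ Finset.Ico a b, 4 * m * h := by
        refine Finset.sum_le_sum fun i hi => ?_
        rw [Finset.mem_Ico] at hi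
        rw [blockSize, if_pos (by omega), mul_comm (4 * m)]
        exact Nat.mul_le_mul_left _ (by omega)
    _ = _ := by rw [Finset.sum_const, Nat.card_Ico, smul_eq_mul, mul_comm]

/-! ### Threshold inequalities for balanced sets. -/

section Arithmetic

variable {m h w J x y z G F G' F' : ℝ}

/-- With `r = 1 / (128 * m)`, the surplus `h * J` in `F` forces `z < 1/2 - 7 * r`. On the last block
this gap, less the error `r`, gains `6 * r * w ≥ 4.5 * h * m`, more than the excess of `F' / 2` over
`G'`. -/
theorem suffix_hidden_arith (hm : 1 ≤ m) (hh : 1 ≤ h) (hw : 96 * h * m ^ 2 ≤ w) (hJ : 1 ≤ J)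
    (hF : F = 2 * G + h * J) (hG : 0 ≤ G) (hFJ : F ≤ 8 * m * h * J) (hF0 : 0 ≤ F')
    (hF' : F' ≤ 2 * G' + 3 * h * m - h) (hx : |x - z * F| ≤ 1 / (128 * m) * F)
    (hy : |y - z * (F' + w)| ≤ 1 / (128 * m) * (F' + w)) (hxG : x < G) :
    y ≤ G' + w / 2 - 1 / 2 := by
  set r := 1 / (128 * m) with hr
  have hrm : r * m = 1 / 128 := by rw [hr]; field_simp
  have hr0 : 0 < r := by positivity
  have hFpos : 0 < F := by nlinarith [mul_pos (show 0 < h by linarith) (show 0 < J by linarith)]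
  have h1 := (abs_le.1 hx).1
  have h2 := (abs_le.1 hy).2
  have h3 : r * F ≤ h * J / 16 := by
    calc r * F ≤ r * (8 * m * h * J) := by gcongr
      _ = (r * m) * (8 * h * J) := by ring
      _ = h * J / 16 := by rw [hrm]; ring
  have hz : z < 1 / 2 - 7 * r := by
    refine lt_of_mul_lt_mul_right ?_ hFpos.le
    nlinarith
  have hw0 : 0 ≤ w := le_trans (by positivity) hw
  have h4 : z * (F' + w) ≤ (1 / 2 - 7 * r) * (F' + w) := by gcongr
  have h5 : 3 / 4 * h * m ≤ r * w := by
    calc 3 / 4 * h * m = (r * m) * (96 * h * m) := by rw [hrm]; ring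
      _ = r * (96 * h * m ^ 2) := by ring
      _ ≤ r * w := by gcongr
  have h6 : 0 ≤ r * F' := by positivity
  nlinarith [mul_le_mul hh hm zero_le_one (by linarith : (0 : ℝ) ≤ h)]

/-- The mirror image, with `z > 1/2 + 3 * r`. The bound `4 ≤ h` lets `h * J / 4` absorb the `- 1` in
`hxG`, which makes room for the lowered capacity. -/
theorem prefix_hidden_arith (hm : 1 ≤ m) (hh : 4 ≤ h) (hw : 96 * h * m ^ 2 ≤ w) (hJ : 1 ≤ J)
    (hF : F + h * J = 2 * G) (hF0 : 0 ≤ F) (hFJ : F ≤ 8 * m * h * J) (hF'0 : 0 ≤ F')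
    (hF' : 2 * G' ≤ F' + h * m) (hx : |x - z * F| ≤ 1 / (128 * m) * F)
    (hy : |y - z * (F' + w)| ≤ 1 / (128 * m) * (F' + w)) (hxG : G - 1 < x) :
    G' + w / 2 + 1 ≤ y := by
  set r := 1 / (128 * m) with hr
  have hrm : r * m = 1 / 128 := by rw [hr]; field_simp
  have hr0 : 0 < r := by positivity
  have h1 := (abs_le.1 hx).2
  have h2 := (abs_le.1 hy).1
  have h3 : r * F ≤ h * J / 16 := by
    calc r * F ≤ r * (8 * m * h * J) := by gcongr
      _ = (r * m) * (8 * h * J) := by ring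
      _ = h * J / 16 := by rw [hrm]; ring
  have hhJ : 4 ≤ h * J := by nlinarith
  have hz : 1 / 2 + 3 * r < z := by
    refine lt_of_mul_lt_mul_right ?_ hF0
    nlinarith
  have hw0 : 0 ≤ w := le_trans (by positivity) hw
  have h4 : (1 / 2 + 3 * r) * (F' + w) ≤ z * (F' + w) := by gcongr
  have h5 : 3 / 4 * h * m ≤ r * w := by
    calc 3 / 4 * h * m = (r * m) * (96 * h * m) := by rw [hrm]; ring
      _ = r * (96 * h * m ^ 2) := by ring
      _ ≤ r * w := by gcongr
  have h6 : 0 ≤ r * F' := by positivity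
  nlinarith [mul_le_mul hh hm zero_le_one (by linarith : (0 : ℝ) ≤ h)]

end Arithmetic

/-! ### Domination of late constraints. -/

section Hidden

variable {U : Type*} {m h w : ℕ} {ℓ : U → ℕ}

theorem card_filter_lt_add_interval (ℓ : U → ℕ) (S : Finset U) {a b : ℕ} (hab : a ≤ b) :
    (S.filter fun u => ℓ u < a).card + (S.filter fun u => a ≤ ℓ u ∧ ℓ u < b).card =
      (S.filter fun u => ℓ u < b).card := by
  classical
  rw [← Finset.card_union_of_disjoint, ← Finset.filter_or]
  · congr 1
    ext u
    simp only [Finset.mem_filter]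
    refine and_congr_right fun _ => ?_
    omega
  · rw [Finset.disjoint_filter]
    intro u _ h1 h2
    omega

/-- On a balanced set, a late suffix constraint is implied by an early one or by `|S|`. -/
theorem suffix_hidden (hℓ : ∀ u, ℓ u ≤ 2 * m) (hh : 1 ≤ h) (hw : 96 * h * m ^ 2 ≤ w) {k : ℕ}
    {S : Finset U} (hS : IsBalanced m h w ℓ k S) {t : ℕ} (htm : t ≤ m) (hkt : k + 3 ≤ 2 * t) :
    suffixCap m h w ((k + 2) / 2) + (S.filter fun u => ℓ u + 1 < 2 * ((k + 2) / 2)).card ≤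
        suffixCap m h w t + (S.filter fun u => ℓ u + 1 < 2 * t).card ∨
      S.card ≤ suffixCap m h w t + (S.filter fun u => ℓ u + 1 < 2 * t).card := by
  obtain ⟨z, hz⟩ := hS
  -- The index `(k + 2) / 2` is the last suffix constraint visible in round `k`.
  obtain ⟨a, ha⟩ : ∃ a, (k + 2) / 2 = a + 1 := ⟨k / 2, by omega⟩
  obtain ⟨b, rfl⟩ : ∃ b, t = b + 1 := ⟨t - 1, by omega⟩
  have hab : a < b := by omega
  have hsplit := card_filter_lt_add_interval ℓ S (show 2 * a + 1 ≤ 2 * b + 1 by omega)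
  have hsplit' := card_filter_lt_add_interval ℓ S (show 2 * b + 1 ≤ 2 * m + 1 by omega)
  have hall : (S.filter fun u => ℓ u < 2 * m + 1) = S :=
    Finset.filter_true_of_mem fun u _ => Nat.lt_succ_of_le (hℓ u)
  rw [hall] at hsplit'
  have hx := abs_card_filter_interval_sub_le hz (a := 2 * a + 1) (b := 2 * b + 1) (by omega)
    (by omega)
  have hy := abs_card_filter_interval_sub_le hz (a := 2 * b + 1) (b := 2 * m + 1) (by omega) le_rfl
  rw [Finset.sum_Ico_succ_top (by omega : 2 * b + 1 ≤ 2 * m), Nat.cast_add] at hy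
  have hlast : blockSize m h w (2 * m) = w := by rw [blockSize, if_neg (lt_irrefl _)]
  rw [hlast] at hy
  have hF := sum_blockSize_odd_interval (h := h) (w := w) hab.le (by omega : b < m)
  have hFJ : ∑ i ∈ Finset.Ico (2 * a + 1) (2 * b + 1), blockSize m h w i ≤
      8 * m * h * (b - a) := by
    refine (sum_blockSize_le (by omega)).trans (le_of_eq ?_)
    rw [show 2 * b + 1 - (2 * a + 1) = 2 * (b - a) by omega]
    ring
  have hF' : ∑ i ∈ Finset.Ico (2 * b + 1) (2 * m), blockSize m h w i + h ≤
      2 * evenSize m h w (b + 1) m + 3 * h * m := by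
    obtain ⟨m', rfl⟩ : ∃ m', m = m' + 1 := ⟨m - 1, by omega⟩
    rw [show 2 * (m' + 1) = 2 * m' + 1 + 1 by ring, Finset.sum_Ico_succ_top (by omega),
      sum_blockSize_odd_interval (by omega : b ≤ m') (by omega), blockSize, if_pos (by omega),
      show 4 * (m' + 1) - 2 - (2 * m' + 1) = 2 * m' + 1 by omega]
    have : h * (m' - b) ≤ h * m' := Nat.mul_le_mul_left _ (by omega)
    nlinarith
  set F := ∑ i ∈ Finset.Ico (2 * a + 1) (2 * b + 1), blockSize m h w i
  set F' := ∑ i ∈ Finset.Ico (2 * b + 1) (2 * m), blockSize m h w i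
  set G := evenSize m h w (a + 1) (b + 1)
  have hcap : suffixCap m h w (a + 1) = G + suffixCap m h w (b + 1) := by
    rw [suffixCap, suffixCap, ← evenSize_add (by omega : a + 1 ≤ b + 1) (by omega : b + 1 ≤ m)]
    ring
  have hset : ∀ c, (S.filter fun u => ℓ u + 1 < 2 * (c + 1)) = S.filter fun u => ℓ u < 2 * c + 1 :=
    fun c => Finset.filter_congr fun u _ => by omega
  rw [ha, hcap, hset, hset]
  by_cases hxG : G ≤ (S.filter fun u => 2 * a + 1 ≤ ℓ u ∧ ℓ u < 2 * b + 1).card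
  · left
    omega
  · right
    push Not at hxG
    have hFr : (F : ℝ) = 2 * G + h * ((b - a : ℕ) : ℝ) := by exact_mod_cast hF
    have hFJr : (F : ℝ) ≤ 8 * m * h * ((b - a : ℕ) : ℝ) := by exact_mod_cast hFJ
    have hF'r : (F' : ℝ) + h ≤ 2 * (evenSize m h w (b + 1) m : ℕ) + 3 * h * m := by
      exact_mod_cast hF'
    have key := suffix_hidden_arith (m := m) (h := h) (w := w) (J := ((b - a : ℕ) : ℝ))
      (G' := (evenSize m h w (b + 1) m : ℕ))
      (by exact_mod_cast (by omega : 1 ≤ m)) (by exact_mod_cast hh) (by exact_mod_cast hw)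
      (by exact_mod_cast (by omega : 1 ≤ b - a)) hFr (by positivity) hFJr (by positivity)
      (by linarith) hx hy (by exact_mod_cast hxG)
    -- The extra `1` pays for rounding down in `w / 2`.
    have key' : 2 * (S.filter fun u => 2 * b + 1 ≤ ℓ u ∧ ℓ u < 2 * m + 1).card + 1 ≤
        2 * evenSize m h w (b + 1) m + w := by
      have : 2 * ((S.filter fun u => 2 * b + 1 ≤ ℓ u ∧ ℓ u < 2 * m + 1).card : ℝ) + 1 ≤
        2 * (evenSize m h w (b + 1) m : ℕ) + w := by linarith
      exact_mod_cast this
    rw [suffixCap]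
    omega

/-- On a balanced set, a late prefix constraint is implied by an early one or by the last one. -/
theorem prefix_hidden (hℓ : ∀ u, ℓ u ≤ 2 * m) (hh : 4 ≤ h) (hw : 96 * h * m ^ 2 ≤ w) {d : ℕ}
    (hd : d ≤ 1) {k : ℕ} {S : Finset U} (hS : IsBalanced m h w ℓ k S) {j : ℕ} (hjm : j ≤ m)
    (hkj : k + 2 ≤ 2 * j) :
    evenSize m h w 0 ((k + 1) / 2) + (S.filter fun u => 2 * ((k + 1) / 2) ≤ ℓ u).card ≤
        prefixCap m h w d j + (S.filter fun u => 2 * j ≤ ℓ u).card ∨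
      evenSize m h w 0 m + w / 2 ≤
        prefixCap m h w d j + (S.filter fun u => 2 * j ≤ ℓ u).card := by
  obtain ⟨z, hz⟩ := hS
  obtain ⟨a, ha⟩ : ∃ a, (k + 1) / 2 = a := ⟨_, rfl⟩
  have haj : a < j := by omega
  have hcount : ∀ c, c ≤ m → (S.filter fun u => 2 * c ≤ ℓ u).card =
      (S.filter fun u => 2 * c ≤ ℓ u ∧ ℓ u < 2 * m + 1).card := fun c _ => by
    congr 1
    exact Finset.filter_congr fun u _ => ⟨fun hu => ⟨hu, Nat.lt_succ_of_le (hℓ u)⟩, fun hu => hu.1⟩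
  have hsplit1 := card_filter_lt_add_interval ℓ S (show 2 * a ≤ 2 * m + 1 by omega)
  have hsplit2 := card_filter_lt_add_interval ℓ S (show 2 * j ≤ 2 * m + 1 by omega)
  have hsplit3 := card_filter_lt_add_interval ℓ S (show 2 * a ≤ 2 * j by omega)
  have hx := abs_card_filter_interval_sub_le hz (a := 2 * a) (b := 2 * j) (by omega) (by omega)
  have hy := abs_card_filter_interval_sub_le hz (a := 2 * j) (b := 2 * m + 1) (by omega) le_rfl
  rw [Finset.sum_Ico_succ_top (by omega : 2 * j ≤ 2 * m), Nat.cast_add] at hy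
  have hlast : blockSize m h w (2 * m) = w := by rw [blockSize, if_neg (lt_irrefl _)]
  rw [hlast] at hy
  have hF := sum_blockSize_even_interval (h := h) (w := w) haj.le hjm
  have hF' := sum_blockSize_even_interval (h := h) (w := w) hjm le_rfl
  have hFJ : ∑ i ∈ Finset.Ico (2 * a) (2 * j), blockSize m h w i ≤ 8 * m * h * (j - a) := by
    refine (sum_blockSize_le (by omega)).trans (le_of_eq ?_)
    rw [show 2 * j - 2 * a = 2 * (j - a) by omega]
    ring
  have hmj : h * (m - j) ≤ h * m := Nat.mul_le_mul_left _ (by omega)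
  set F := ∑ i ∈ Finset.Ico (2 * a) (2 * j), blockSize m h w i
  set F' := ∑ i ∈ Finset.Ico (2 * j) (2 * m), blockSize m h w i
  have hcapa := evenSize_add (m := m) (h := h) (w := w) (Nat.zero_le a) haj.le
  have hcapj := evenSize_add (m := m) (h := h) (w := w) (Nat.zero_le j) hjm
  set G := evenSize m h w a j
  -- One unit of slack treats `d = 0` and `d = 1` alike.
  have hcap : evenSize m h w 0 j ≤ prefixCap m h w d j + 1 := by
    rw [prefixCap]
    split_ifs with h1 h2
    · omega
    · rw [h2]
      omega
    · omega
  rw [ha, hcount a (by omega), hcount j hjm]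
  by_cases hxG : (S.filter fun u => 2 * a ≤ ℓ u ∧ ℓ u < 2 * j).card + 1 ≤ G
  · left
    omega
  · right
    push Not at hxG
    have hFr : (F : ℝ) + h * ((j - a : ℕ) : ℝ) = 2 * G := by exact_mod_cast hF
    have hFJr : (F : ℝ) ≤ 8 * m * h * ((j - a : ℕ) : ℝ) := by exact_mod_cast hFJ
    have hF'r : 2 * ((evenSize m h w j m : ℕ) : ℝ) ≤ F' + h * m := by
      exact_mod_cast (show 2 * evenSize m h w j m ≤ F' + h * m by omega)
    have hxr : (G : ℝ) < (S.filter fun u => 2 * a ≤ ℓ u ∧ ℓ u < 2 * j).card + 1 := by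
      exact_mod_cast hxG
    have key := prefix_hidden_arith (m := m) (h := h) (w := w) (J := ((j - a : ℕ) : ℝ))
      (by exact_mod_cast (by omega : 1 ≤ m)) (by exact_mod_cast hh) (by exact_mod_cast hw)
      (by exact_mod_cast (by omega : 1 ≤ j - a)) hFr (by positivity) hFJr (by positivity)
      hF'r hx hy (by linarith)
    have key' : 2 * evenSize m h w j m + w + 2 ≤
        2 * (S.filter fun u => 2 * j ≤ ℓ u ∧ ℓ u < 2 * m + 1).card := by
      have : 2 * ((evenSize m h w j m : ℕ) : ℝ) + w + 2 ≤
        2 * ((S.filter fun u => 2 * j ≤ ℓ u ∧ ℓ u < 2 * m + 1).card : ℝ) := by linarith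
      exact_mod_cast this
    omega

end Hidden

/-! ### Runs with hidden constraints -/

section Ideal

variable {U : Type*} [DecidableEq U]

/-- The answer to a query in round `k` when the constraints hidden in this round are dropped. -/
def visibleAnswer (m h w : ℕ) (ℓ : U → ℕ) (k : ℕ) : RankQuery U → ℕ
  | Sum.inl S => ((Finset.range (m + 1)).filter fun t => 2 * t ≤ k + 2).fold min S.card
      fun t => suffixCap m h w t + (S.filter fun u => ℓ u + 1 < 2 * t).card
  -- The constant term is the constraint on the whole universe. When `k + 2 ≤ 2 * m`, only `j < m`
  -- remain in the fold, so `d` plays no role.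
  | Sum.inr S => ((Finset.Icc 1 m).filter fun j => 2 * j ≤ k + 1).fold min
      (min S.card (evenSize m h w 0 m + w / 2))
      fun j => evenSize m h w 0 j + (S.filter fun u => 2 * j ≤ ℓ u).card

/-- The set a rank query asks for. -/
def querySet : RankQuery U → Finset U := Sum.elim id id

/-- The transcript after `k` rounds that are answered by `visibleAnswer`. -/
def visibleTranscript (A : RoundAlgorithm U) (m h w : ℕ) (ℓ : U → ℕ) : ℕ → Transcript U
  | 0 => []
  | k + 1 => visibleTranscript A m h w ℓ k ++
      [(A.query (visibleTranscript A m h w ℓ k)).image fun q => (q, visibleAnswer m h w ℓ k q)]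

/-- In round `k` an algorithm with query budget `Q` asks for an unbalanced set. -/
def AsksUnbalanced (A : RoundAlgorithm U) (Q : ℝ) (m h w : ℕ) (ℓ : U → ℕ) (k : ℕ) : Prop :=
  ((A.query (visibleTranscript A m h w ℓ k)).card : ℝ) ≤ Q ∧
    ∃ q ∈ A.query (visibleTranscript A m h w ℓ k), ¬ IsBalanced m h w ℓ k (querySet q)

omit [DecidableEq U] in
theorem visibleAnswer_congr (m h w : ℕ) {ℓ ℓ' : U → ℕ} {k : ℕ}
    (H : ∀ u, min (ℓ u) (k + 1) = min (ℓ' u) (k + 1)) :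
    visibleAnswer m h w ℓ k = visibleAnswer m h w ℓ' k := by
  funext q
  cases q with
  | inl S =>
    refine Finset.fold_congr fun t ht => ?_
    have ht' := (Finset.mem_filter.1 ht).2
    congr 2
    refine Finset.filter_congr fun u _ => ?_
    have := H u
    omega
  | inr S =>
    refine Finset.fold_congr fun j hj => ?_
    have hj' := (Finset.mem_filter.1 hj).2
    congr 2
    refine Finset.filter_congr fun u _ => ?_
    have := H u
    omega

/-- The first `k` rounds depend on the blocks with index less than `k` only. -/
theorem visibleTranscript_congr (A : RoundAlgorithm U) (m h w : ℕ) {ℓ ℓ' : U → ℕ} {k : ℕ}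
    (H : ∀ u, min (ℓ u) k = min (ℓ' u) k) :
    visibleTranscript A m h w ℓ k = visibleTranscript A m h w ℓ' k := by
  induction k with
  | zero => rfl
  | succ k ih =>
    have H' : ∀ u, min (ℓ u) k = min (ℓ' u) k := fun u => by
      have := H u
      omega
    rw [visibleTranscript, visibleTranscript, ih H', visibleAnswer_congr m h w H]

/-- The dropped constraints never attain a smaller minimum on balanced sets. Since the right-hand
side is free of `d`, the two hard instances answer alike. -/
theorem rankAnswer_eq_visibleAnswer [Fintype U] {m h w : ℕ} {ℓ : U → ℕ} (hℓ : ∀ u, ℓ u ≤ 2 * m)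
    (hh : 4 ≤ h) (hw : 96 * h * m ^ 2 ≤ w) {d : ℕ} (hd : d ≤ 1) {k : ℕ} (hk : k + 2 ≤ 2 * m)
    {q : RankQuery U} (hq : IsBalanced m h w ℓ k (querySet q)) :
    rankAnswer (suffixMatroid m h w ℓ) (prefixMatroid m h w d ℓ) q =
      visibleAnswer m h w ℓ k q := by
  refine eq_of_forall_le_iff fun c => ?_
  cases q with
  | inl S =>
    rw [rankAnswer, le_suffixMatroid_rank_iff, visibleAnswer, Finset.le_fold_min]
    refine and_congr_right fun hcS => ⟨fun H t ht => ?_, fun H t ht => ?_⟩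
    · simp only [Finset.mem_filter, Finset.mem_range] at ht
      exact H t (by omega)
    · rcases Nat.lt_or_ge (k + 2) (2 * t) with hkt | hkt
      · rcases suffix_hidden hℓ (by omega) hw (k := k) (S := S) hq ht hkt with h1 | h1
        · refine (H ((k + 2) / 2) ?_).trans h1
          simp only [Finset.mem_filter, Finset.mem_range]
          omega
        · exact hcS.trans h1
      · refine H t ?_
        simp only [Finset.mem_filter, Finset.mem_range]
        omega
  | inr S =>
    rw [rankAnswer, le_prefixMatroid_rank_iff, visibleAnswer, Finset.le_fold_min, le_min_iff,
      and_assoc]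
    have htop : prefixCap m h w d (m + 1) + (S.filter fun u => 2 * (m + 1) ≤ ℓ u).card =
        evenSize m h w 0 m + w / 2 := by
      rw [prefixCap, if_neg (by omega), if_neg (by omega), Finset.filter_false_of_mem,
        Finset.card_empty, add_zero]
      intro u _
      have := hℓ u
      omega
    refine and_congr_right fun hcS => ⟨fun H => ⟨?_, fun j hj => ?_⟩, fun H j hj1 hjm => ?_⟩
    · rw [← htop]
      exact H (m + 1) (by omega) le_rfl
    · simp only [Finset.mem_filter, Finset.mem_Icc] at hj
      have := H j (by omega) (by omega)
      rwa [prefixCap, if_pos (by omega)] at this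
    · obtain ⟨H1, H2⟩ := H
      rcases Nat.lt_or_ge m j with hj | hj
      · obtain rfl : j = m + 1 := by omega
        rwa [htop]
      rcases Nat.lt_or_ge (k + 1) (2 * j) with hkj | hkj
      · rcases prefix_hidden hℓ hh hw hd (k := k) (S := S) hq hj hkj with h1 | h1
        · refine le_trans ?_ h1
          -- In round `0` no proper prefix is visible yet, and the dominating bound is `|S|` itself.
          rcases Nat.eq_zero_or_pos ((k + 1) / 2) with h0 | h0
          · rw [h0, evenSize, Finset.Ico_self, Finset.sum_empty, zero_add]
            simpa using hcS
          · refine H2 _ ?_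
            simp only [Finset.mem_filter, Finset.mem_Icc]
            omega
        · exact H1.trans h1
      · rw [prefixCap, if_pos (by omega)]
        refine H2 j ?_
        simp only [Finset.mem_filter, Finset.mem_Icc]
        omega

theorem transcript_eq_visibleTranscript [Fintype U] {m h w : ℕ} {ℓ : U → ℕ}
    (hℓ : IsStaircase m h w ℓ) (hh : 4 ≤ h) (hw : 96 * h * m ^ 2 ≤ w) {d : ℕ} (hd : d ≤ 1)
    (A : RoundAlgorithm U) {Q : ℝ} {s : ℕ} (hs : s + 1 ≤ 2 * m)
    (hQ : ∀ k < s, ((A.roundQueries (suffixMatroid m h w ℓ) (prefixMatroid m h w d ℓ) k).card : ℝ)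
      ≤ Q)
    (hbal : ∀ k < s, ¬ AsksUnbalanced A Q m h w ℓ k) :
    A.transcript (suffixMatroid m h w ℓ) (prefixMatroid m h w d ℓ) s =
      visibleTranscript A m h w ℓ s := by
  induction s with
  | zero => rfl
  | succ s ih =>
    have ih' := ih (by omega) (fun k hk => hQ k (by omega)) (fun k hk => hbal k (by omega))
    rw [RoundAlgorithm.transcript, visibleTranscript, ih']
    congr 2
    refine Finset.image_congr fun q hq => ?_
    -- The query budget is known only for runs on actual inputs; agreement of the earlier rounds
    -- transfers it to the visible run.
    have hcard := hQ s (by omega)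
    rw [RoundAlgorithm.roundQueries, ih'] at hcard
    have hqb : IsBalanced m h w ℓ s (querySet q) := by
      by_contra hcon
      exact hbal s (by omega) ⟨hcard, q, Finset.mem_coe.1 hq, hcon⟩
    rw [rankAnswer_eq_visibleAnswer hℓ.le hh hw hd (by omega) hqb]

end Ideal

/-! ### Random labellings -/

section Random

variable {U : Type*} [Fintype U] [DecidableEq U]

omit [DecidableEq U] in
theorem IsStaircase.comp_perm {m h w : ℕ} {b : U → ℕ} (hb : IsStaircase m h w b)
    (σ : Equiv.Perm U) : IsStaircase m h w fun u => b (σ⁻¹ u) where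
  le u := hb.le _
  card_eq i hi := by
    rw [← hb.card_eq i hi]
    exact Finset.card_equiv σ⁻¹ fun u => by simp

open Classical in
/-- Averaging over the permutations of a subset. -/
theorem card_perm_le_of_forall_coset (V : U → Prop) [DecidablePred V] (p : Equiv.Perm U → Prop) {c : ℝ}
    (H : ∀ σ, ((Finset.univ.filter fun τ : Equiv.Perm {x // V x} =>
      p (σ * Equiv.Perm.ofSubtype τ)).card : ℝ) ≤ c * (Fintype.card {x // V x}).factorial) :
    ((Finset.univ.filter p).card : ℝ) ≤ c * (Fintype.card U).factorial := by
  have hpos : (0 : ℝ) < (Fintype.card {x // V x}).factorial := by positivity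
  have hsum : ∑ σ : Equiv.Perm U, (Finset.univ.filter fun τ : Equiv.Perm {x // V x} =>
      p (σ * Equiv.Perm.ofSubtype τ)).card =
      (Fintype.card {x // V x}).factorial * (Finset.univ.filter p).card := by
    simp only [Finset.card_eq_sum_ones, Finset.sum_filter]
    rw [Finset.sum_comm]
    have : ∀ τ : Equiv.Perm {x // V x},
        ∑ σ : Equiv.Perm U, (if p (σ * Equiv.Perm.ofSubtype τ) then 1 else 0) =
          ∑ σ : Equiv.Perm U, if p σ then 1 else 0 := fun τ =>
      Equiv.sum_comp (Equiv.mulRight (Equiv.Perm.ofSubtype τ)) fun σ => if p σ then 1 else 0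
    rw [Finset.sum_congr rfl fun τ _ => this τ, Finset.sum_const, Finset.card_univ,
      Fintype.card_perm, smul_eq_mul]
  refine le_of_mul_le_mul_left ?_ hpos
  calc _ = ((∑ σ : Equiv.Perm U, (Finset.univ.filter fun τ : Equiv.Perm {x // V x} =>
          p (σ * Equiv.Perm.ofSubtype τ)).card : ℕ) : ℝ) := by rw [hsum]; push_cast; rfl
    _ ≤ ∑ σ : Equiv.Perm U, c * (Fintype.card {x // V x}).factorial := by
        push_cast
        exact Finset.sum_le_sum fun σ _ => H σ
    _ = _ := by
        rw [Finset.sum_const, Finset.card_univ, Fintype.card_perm, nsmul_eq_mul]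
        ring

-- Shuffling the blocks from `k` on leaves the blocks below `k` in place, so it does not affect the
-- visible run of the first `k` rounds.
omit [Fintype U] [DecidableEq U] in
theorem ofSubtype_label {b : U → ℕ} {k : ℕ} (τ : Equiv.Perm {x // k ≤ b x}) (x : U) :
    min (b (Equiv.Perm.ofSubtype τ x)) k = min (b x) k := by
  by_cases hx : k ≤ b x
  · rw [Equiv.Perm.ofSubtype_apply_of_mem τ hx, min_eq_right (τ ⟨x, hx⟩).2, min_eq_right hx]
  · rw [Equiv.Perm.ofSubtype_apply_of_not_mem τ hx]

theorem le_blockSize {m h w i : ℕ} (hm : 1 ≤ m) (hw : 96 * h * m ^ 2 ≤ w) :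
    h * m ≤ blockSize m h w i := by
  rw [blockSize]
  split_ifs with hi
  · exact Nat.mul_le_mul_left h (by omega)
  · refine le_trans ?_ hw
    nlinarith [Nat.mul_le_mul_left h (Nat.mul_le_mul hm le_rfl : 1 * m ≤ m * m)]

-- Within the shuffled part, the blocks from `k` on are random sets of fixed size, so each meets `S`
-- in about the overall density of `S` there. The tail bound and a union bound over at most `2 * m +
-- 1` blocks finish.
open Classical in
theorem card_perm_not_isBalanced_le {m h w : ℕ} (hm : 1 ≤ m) (hw : 96 * h * m ^ 2 ≤ w) {b : U → ℕ}
    (hb : IsStaircase m h w b) (k : ℕ) (σ : Equiv.Perm U) (S : Finset U) :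
    ((Finset.univ.filter fun τ : Equiv.Perm {x // k ≤ b x} =>
      ¬ IsBalanced m h w (fun u => b ((σ * Equiv.Perm.ofSubtype τ)⁻¹ u)) k S).card : ℝ) ≤
      (2 * m + 1) * (2 * Real.exp (-(h / (65536 * m)))) *
        (Fintype.card {x // k ≤ b x}).factorial := by
  set V := {x // k ≤ b x}
  let T : Finset V := Finset.univ.filter fun p => σ p ∈ S
  let B : ℕ → Finset V := fun i => Finset.univ.filter fun p => b p = i
  have hmr : (1 : ℝ) ≤ m := by exact_mod_cast hm
  have hBcard : ∀ i, k ≤ i → i ≤ 2 * m → (B i).card = blockSize m h w i := by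
    intro i hki hi
    rw [← hb.card_eq i hi, ← Finset.card_map (Function.Embedding.subtype _)]
    congr 1
    ext u
    simp [B]
    omega
  have hcount : ∀ (τ : Equiv.Perm V) i, k ≤ i →
      (S.filter fun u => b ((σ * Equiv.Perm.ofSubtype τ)⁻¹ u) = i).card =
        ((B i).filter fun x => τ x ∈ T).card := by
    intro τ i hki
    symm
    refine Finset.card_bij (fun x _ => σ (τ x)) ?_ ?_ ?_
    · intro x hx
      simp only [B, T, Finset.mem_filter, Finset.mem_univ, true_and] at hx ⊢
      refine ⟨hx.2, ?_⟩
      rw [← hx.1, ← Equiv.Perm.ofSubtype_apply_coe, ← Equiv.Perm.mul_apply σ]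
      exact congrArg b (Equiv.symm_apply_apply _ _)
    · intro x _ y _ hxy
      exact τ.injective (Subtype.ext (σ.injective hxy))
    · intro u hu
      obtain ⟨huS, hui⟩ := Finset.mem_filter.1 hu
      have hx : k ≤ b ((σ * Equiv.Perm.ofSubtype τ)⁻¹ u) := hui ▸ hki
      have hux : σ (τ ⟨_, hx⟩) = u := by
        rw [← Equiv.Perm.ofSubtype_apply_coe, ← Equiv.Perm.mul_apply]
        exact Equiv.apply_symm_apply _ _
      refine ⟨⟨_, hx⟩, ?_, hux⟩
      simp only [B, T, Finset.mem_filter, Finset.mem_univ, true_and, hux]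
      exact ⟨hui, huS⟩
  have hsub : (Finset.univ.filter fun τ : Equiv.Perm V =>
      ¬ IsBalanced m h w (fun u => b ((σ * Equiv.Perm.ofSubtype τ)⁻¹ u)) k S) ⊆
      (Finset.Icc k (2 * m)).biUnion fun i => Finset.univ.filter fun τ : Equiv.Perm V =>
        1 / (128 * (m : ℝ)) * (B i).card < |(((B i).filter fun x => τ x ∈ T).card : ℝ) -
          (T.card : ℝ) / Fintype.card V * (B i).card| := by
    intro τ hτ
    have hτ' := (Finset.mem_filter.1 hτ).2
    rw [IsBalanced] at hτ'
    push Not at hτ'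
    obtain ⟨i, hki, hi, hlt⟩ := hτ' ((T.card : ℝ) / Fintype.card V)
    rw [Finset.mem_biUnion]
    refine ⟨i, Finset.mem_Icc.2 ⟨hki, hi⟩, Finset.mem_filter.2 ⟨Finset.mem_univ _, ?_⟩⟩
    rw [hcount τ i hki, ← hBcard i hki hi] at hlt
    exact hlt
  have hterm : ∀ i ∈ Finset.Icc k (2 * m), ((Finset.univ.filter fun τ : Equiv.Perm V =>
        1 / (128 * (m : ℝ)) * (B i).card < |(((B i).filter fun x => τ x ∈ T).card : ℝ) -
          (T.card : ℝ) / Fintype.card V * (B i).card|).card : ℝ) ≤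
      2 * Real.exp (-(h / (65536 * m))) * (Fintype.card V).factorial := by
    intro i hi
    rw [Finset.mem_Icc] at hi
    refine (card_perm_two_sided_tail_le T (B i) (by positivity) ?_).trans ?_
    · rw [div_le_iff₀ (by positivity)]
      linarith
    · gcongr ?_ * Real.exp (-?_) * _
      have hsz : (h : ℝ) * m ≤ (B i).card := by
        rw [hBcard i hi.1 hi.2]
        exact_mod_cast le_blockSize hm hw
      -- Here `65536 = 4 * 128 ^ 2`, and `h * m` bounds the block sizes from below.
      calc (h : ℝ) / (65536 * m) = (1 / (128 * (m : ℝ))) ^ 2 * (h * m) / 4 := by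
            field_simp
            ring
        _ ≤ _ := by gcongr
  have h3 : (_ : ℝ) ≤ _ := Nat.cast_le.2 ((Finset.card_le_card hsub).trans Finset.card_biUnion_le)
  refine h3.trans ?_
  push_cast
  refine (Finset.sum_le_card_nsmul _ _ _ hterm).trans ?_
  rw [nsmul_eq_mul, Nat.card_Icc, mul_assoc (2 * (m : ℝ) + 1)]
  gcongr
  exact_mod_cast (by omega : 2 * m + 1 - k ≤ 2 * m + 1)

open Classical in
/-- An algorithm rarely asks for an unbalanced set. -/
theorem card_perm_asksUnbalanced_le {m h w : ℕ} (hm : 1 ≤ m) (hw : 96 * h * m ^ 2 ≤ w) {b : U → ℕ}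
    (hb : IsStaircase m h w b) (A : RoundAlgorithm U) {Q : ℝ} (hQ : 0 ≤ Q) (k : ℕ) :
    ((Finset.univ.filter fun σ : Equiv.Perm U =>
      AsksUnbalanced A Q m h w (fun u => b (σ⁻¹ u)) k).card : ℝ) ≤
      Q * ((2 * m + 1) * (2 * Real.exp (-(h / (65536 * m))))) * (Fintype.card U).factorial := by
  refine card_perm_le_of_forall_coset (fun x => k ≤ b x) _ fun σ => ?_
  -- The queries of round `k` are constant on the coset, so they are fixed sets while `τ` is random.
  have hT : ∀ τ : Equiv.Perm {x // k ≤ b x},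
      visibleTranscript A m h w (fun u => b ((σ * Equiv.Perm.ofSubtype τ)⁻¹ u)) k =
        visibleTranscript A m h w (fun u => b (σ⁻¹ u)) k := fun τ =>
    visibleTranscript_congr A m h w fun u => by
      rw [mul_inv_rev, Equiv.Perm.mul_apply, ← map_inv, ofSubtype_label]
  simp only [AsksUnbalanced, hT]
  set X := A.query (visibleTranscript A m h w (fun u => b (σ⁻¹ u)) k)
  by_cases hX : (X.card : ℝ) ≤ Q
  · have hsub : (Finset.univ.filter fun τ : Equiv.Perm {x // k ≤ b x} => (X.card : ℝ) ≤ Q ∧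
        ∃ q ∈ X, ¬ IsBalanced m h w (fun u => b ((σ * Equiv.Perm.ofSubtype τ)⁻¹ u)) k
          (querySet q)) ⊆
        X.biUnion fun q => Finset.univ.filter fun τ : Equiv.Perm {x // k ≤ b x} =>
          ¬ IsBalanced m h w (fun u => b ((σ * Equiv.Perm.ofSubtype τ)⁻¹ u)) k (querySet q) := by
      intro τ hτ
      obtain ⟨-, q, hq, hqb⟩ := (Finset.mem_filter.1 hτ).2
      exact Finset.mem_biUnion.2 ⟨q, hq, Finset.mem_filter.2 ⟨Finset.mem_univ _, hqb⟩⟩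
    have h3 : (_ : ℝ) ≤ _ :=
      Nat.cast_le.2 ((Finset.card_le_card hsub).trans Finset.card_biUnion_le)
    refine h3.trans ?_
    push_cast
    refine (Finset.sum_le_card_nsmul _ _ _ fun q _ =>
      card_perm_not_isBalanced_le hm hw hb k σ (querySet q)).trans ?_
    rw [nsmul_eq_mul, mul_assoc Q]
    gcongr
  · simp only [hX, false_and, Finset.filter_false, Finset.card_empty, Nat.cast_zero]
    positivity

end Random

/-! ### The lower bound on the number of rounds -/

section LowerBound

variable {U : Type*} [Fintype U] [DecidableEq U]

open Classical in
/-- With few rounds, few labellings allow an algorithm to tell the two hard instances apart. -/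
theorem card_perm_result_ne_le {m h w : ℕ} (hm : 1 ≤ m) (hh : 4 ≤ h) (hw : 96 * h * m ^ 2 ≤ w)
    {b : U → ℕ} (hb : IsStaircase m h w b) (A : RoundAlgorithm U) {Q : ℝ} (hQ0 : 0 ≤ Q) {s : ℕ}
    (hs : s + 1 ≤ 2 * m)
    (hQ : ∀ M₁ M₂ : Matroid U, IsNestedMatroid M₁ → IsNestedMatroid M₂ →
      ∀ k < s, ((A.roundQueries M₁ M₂ k).card : ℝ) ≤ Q) :
    ((Finset.univ.filter fun σ : Equiv.Perm U =>
      A.result (suffixMatroid m h w fun u => b (σ⁻¹ u))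
        (prefixMatroid m h w 0 fun u => b (σ⁻¹ u)) s ≠
      A.result (suffixMatroid m h w fun u => b (σ⁻¹ u))
        (prefixMatroid m h w 1 fun u => b (σ⁻¹ u)) s).card : ℝ) ≤
      s * (Q * ((2 * m + 1) * (2 * Real.exp (-(h / (65536 * m)))))) *
        (Fintype.card U).factorial := by
  have hsub : (Finset.univ.filter fun σ : Equiv.Perm U =>
      A.result (suffixMatroid m h w fun u => b (σ⁻¹ u))
        (prefixMatroid m h w 0 fun u => b (σ⁻¹ u)) s ≠
      A.result (suffixMatroid m h w fun u => b (σ⁻¹ u))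
        (prefixMatroid m h w 1 fun u => b (σ⁻¹ u)) s) ⊆
      (Finset.range s).biUnion fun k => Finset.univ.filter fun σ : Equiv.Perm U =>
        AsksUnbalanced A Q m h w (fun u => b (σ⁻¹ u)) k := by
    intro σ hσ
    by_contra hcon
    have hbal : ∀ k < s, ¬ AsksUnbalanced A Q m h w (fun u => b (σ⁻¹ u)) k := fun k hk hbad =>
      hcon (Finset.mem_biUnion.2
        ⟨k, Finset.mem_range.2 hk, Finset.mem_filter.2 ⟨Finset.mem_univ _, hbad⟩⟩)
    have hσb := hb.comp_perm σ
    have hrun : ∀ d ≤ 1, A.transcript (suffixMatroid m h w fun u => b (σ⁻¹ u))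
        (prefixMatroid m h w d fun u => b (σ⁻¹ u)) s =
        visibleTranscript A m h w (fun u => b (σ⁻¹ u)) s := fun d hd =>
      transcript_eq_visibleTranscript hσb hh hw hd A hs
        (hQ _ _ (isNestedMatroid_suffixMatroid m h w _) (isNestedMatroid_prefixMatroid d hσb)) hbal
    refine (Finset.mem_filter.1 hσ).2 ?_
    rw [RoundAlgorithm.result, RoundAlgorithm.result, hrun 0 zero_le_one, hrun 1 le_rfl]
  have h3 : (_ : ℝ) ≤ _ := Nat.cast_le.2 ((Finset.card_le_card hsub).trans Finset.card_biUnion_le)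
  refine h3.trans ?_
  push_cast
  refine (Finset.sum_le_card_nsmul _ _ _ fun k _ =>
    card_perm_asksUnbalanced_le hm hw hb A hQ0 k).trans ?_
  rw [Finset.card_range, nsmul_eq_mul, ← mul_assoc (s : ℝ)]

-- Yao's averaging: correctness on both instances forces their outputs to differ with probability at
-- least `1/3` for every labelling, whereas for every outcome `ω` they differ on less than a third
-- of the labellings.
open Classical in
theorem two_mul_le_rounds {m h w : ℕ} (hm : 1 ≤ m) (hh : 4 ≤ h) (hw : 96 * h * m ^ 2 ≤ w)
    {b : U → ℕ} (hb : IsStaircase m h w b) {Ω : Type*} [MeasurableSpace Ω] (P : Measure Ω)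
    [IsProbabilityMeasure P] {A : Ω → RoundAlgorithm U} {Q : ℝ} (hQ0 : 0 ≤ Q) {s : ℕ}
    (hA : SolvesNestedMatroidIntersection P A s Q)
    (hsmall : 2 * m * (Q * ((2 * m + 1) * (2 * Real.exp (-(h / (65536 * m)))))) < 1 / 3) :
    2 * m ≤ s := by
  by_contra hcon
  have hs : s + 1 ≤ 2 * m := by omega
  let r : ℕ → Equiv.Perm U → Ω → ℕ := fun d σ ω =>
    (A ω).result (suffixMatroid m h w fun u => b (σ⁻¹ u))
      (prefixMatroid m h w d fun u => b (σ⁻¹ u)) s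
  let v : ℕ → Equiv.Perm U → ℕ := fun d σ =>
    matroidIntersectionValue (suffixMatroid m h w fun u => b (σ⁻¹ u))
      (prefixMatroid m h w d fun u => b (σ⁻¹ u))
  let D : Equiv.Perm U → Set Ω := fun σ => {ω | r 0 σ ω ≠ r 1 σ ω}
  have hn1 : ∀ σ : Equiv.Perm U, IsNestedMatroid (suffixMatroid m h w fun u => b (σ⁻¹ u)) :=
    fun σ => isNestedMatroid_suffixMatroid m h w _
  have hn2 : ∀ d (σ : Equiv.Perm U), IsNestedMatroid (prefixMatroid m h w d fun u => b (σ⁻¹ u)) :=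
    fun d σ => isNestedMatroid_prefixMatroid d (hb.comp_perm σ)
  have hmeas : ∀ d σ, Measurable (r d σ) := fun d σ =>
    hA.measurable_result _ _ (hn1 σ) (hn2 d σ)
  have hD : ∀ σ, MeasurableSet (D σ) := fun σ =>
    (measurableSet_eq_fun (hmeas 0 σ) (hmeas 1 σ)).compl
  have hv : ∀ σ, v 1 σ < v 0 σ := fun σ =>
    (matroidIntersectionValue_lt hm (by omega) _).trans_le
      (le_matroidIntersectionValue (hb.comp_perm σ))
  have hDlow : ∀ σ, 1 / 3 ≤ P.real (D σ) := by
    intro σ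
    have h0 : 2 / 3 ≤ P.real {ω | r 0 σ ω = v 0 σ} := hA.success _ _ (hn1 σ) (hn2 0 σ)
    have h1 : 2 / 3 ≤ P.real {ω | r 1 σ ω = v 1 σ} := hA.success _ _ (hn1 σ) (hn2 1 σ)
    have hm1 : MeasurableSet {ω | r 1 σ ω = v 1 σ} :=
      measurableSet_eq_fun (hmeas 1 σ) measurable_const
    have hsub : {ω | r 0 σ ω = v 0 σ} ⊆ D σ ∪ {ω | r 1 σ ω = v 1 σ}ᶜ := by
      intro ω hω
      by_cases hω1 : r 1 σ ω = v 1 σ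
      · left
        have hω' : r 0 σ ω = v 0 σ := hω
        change r 0 σ ω ≠ r 1 σ ω
        rw [hω', hω1]
        exact (hv σ).ne'
      · exact Or.inr hω1
    have h2 := (measureReal_mono (μ := P) hsub).trans (measureReal_union_le _ _)
    rw [probReal_compl_eq_one_sub hm1] at h2
    linarith
  have hcount : ∀ ω, ∑ σ, (D σ).indicator (1 : Ω → ℝ) ω ≤
      s * (Q * ((2 * m + 1) * (2 * Real.exp (-(h / (65536 * m)))))) *
        (Fintype.card U).factorial := by
    intro ω
    have := card_perm_result_ne_le hm hh hw hb (A ω) hQ0 hs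
      fun M₁ M₂ hM₁ hM₂ k hk => hA.queries_le M₁ M₂ hM₁ hM₂ ω k hk
    refine le_trans (le_of_eq ?_) this
    rw [Finset.card_filter]
    push_cast
    refine Finset.sum_congr rfl fun σ _ => ?_
    rw [Set.indicator_apply]
    rfl
  have hInt : ∀ σ, Integrable ((D σ).indicator (1 : Ω → ℝ)) P := fun σ =>
    (integrable_const (1 : ℝ)).indicator (hD σ)
  have hint : ∑ σ, P.real (D σ) ≤ s * (Q * ((2 * m + 1) * (2 * Real.exp (-(h / (65536 * m)))))) *
      (Fintype.card U).factorial := by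
    calc ∑ σ, P.real (D σ) = ∫ ω, ∑ σ, (D σ).indicator (1 : Ω → ℝ) ω ∂P := by
          rw [integral_finsetSum _ fun σ _ => hInt σ]
          exact Finset.sum_congr rfl fun σ _ => (integral_indicator_one (hD σ)).symm
      _ ≤ ∫ _, (s * (Q * ((2 * m + 1) * (2 * Real.exp (-(h / (65536 * m)))))) *
            (Fintype.card U).factorial : ℝ) ∂P :=
          integral_mono (integrable_finsetSum _ fun σ _ => hInt σ) (integrable_const _) hcount
      _ = _ := by simp
  have hlow : (1 / 3 : ℝ) * (Fintype.card U).factorial ≤ ∑ σ, P.real (D σ) := by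
    have := Finset.card_nsmul_le_sum Finset.univ (fun σ => P.real (D σ)) _ fun σ _ => hDlow σ
    rw [Finset.card_univ, Fintype.card_perm, nsmul_eq_mul] at this
    linarith
  have hfac : (0 : ℝ) < (Fintype.card U).factorial := by positivity
  have hle := le_of_mul_le_mul_right (hlow.trans hint) hfac
  have hs' : (s : ℝ) ≤ 2 * m := by exact_mod_cast (by omega : s ≤ 2 * m)
  have : s * (Q * ((2 * m + 1) * (2 * Real.exp (-(h / (65536 * m)))))) ≤
      2 * m * (Q * ((2 * m + 1) * (2 * Real.exp (-(h / (65536 * m)))))) := by gcongr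
  linarith

end LowerBound

/-! ### Choice of parameters. -/

/-- The shrinking blocks take at most `8 * h * m ^ 2` elements, and all others go to the last block;
hence `104 = 96 + 8`. -/
theorem exists_isStaircase {N m h : ℕ} (hN : 104 * h * m ^ 2 ≤ N) :
    ∃ w, 96 * h * m ^ 2 ≤ w ∧ ∃ b : Fin N → ℕ, IsStaircase m h w b := by
  have hle : ∑ i ∈ Finset.range (2 * m), h * (4 * m - 2 - i) ≤ 8 * h * m ^ 2 := by
    calc _ ≤ ∑ i ∈ Finset.range (2 * m), h * (4 * m) :=
          Finset.sum_le_sum fun i _ => Nat.mul_le_mul_left h (by omega)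
      _ = _ := by
          rw [Finset.sum_const, Finset.card_range, smul_eq_mul]
          ring
  set F := ∑ i ∈ Finset.range (2 * m), h * (4 * m - 2 - i)
  refine ⟨N - F, by rw [show 104 * h * m ^ 2 = 96 * h * m ^ 2 + 8 * h * m ^ 2 by ring] at hN; omega,
    ?_⟩
  have hsum : ∑ i : Fin (2 * m + 1), blockSize m h (N - F) i = N := by
    rw [Fin.sum_univ_eq_sum_range, Finset.sum_range_succ]
    have h1 : ∑ i ∈ Finset.range (2 * m), blockSize m h (N - F) i = F :=
      Finset.sum_congr rfl fun i hi => by rw [blockSize, if_pos (Finset.mem_range.1 hi)]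
    have h2 : blockSize m h (N - F) (2 * m) = N - F := by rw [blockSize, if_neg (lt_irrefl _)]
    rw [h1, h2]
    have : 8 * h * m ^ 2 ≤ 104 * h * m ^ 2 :=
      Nat.mul_le_mul_right _ (Nat.mul_le_mul_right _ (by norm_num))
    omega
  have e : Fin N ≃ Σ i : Fin (2 * m + 1), Fin (blockSize m h (N - F) i) :=
    Fintype.equivOfCardEq (by simp [hsum])
  refine ⟨fun p => (e p).1, fun p => Nat.lt_succ_iff.1 (e p).1.2, fun i hi => ?_⟩
  have hfib : (Finset.univ.filter fun p => ((e p).1 : ℕ) = i) =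
      (Finset.univ : Finset (Fin (blockSize m h (N - F) i))).map
        ((Function.Embedding.sigmaMk (β := fun i : Fin (2 * m + 1) =>
          Fin (blockSize m h (N - F) i)) ⟨i, Nat.lt_succ_of_le hi⟩).trans e.symm.toEmbedding) := by
    ext p
    simp only [Finset.mem_filter, Finset.mem_univ, true_and, Finset.mem_map,
      Function.Embedding.trans_apply, Function.Embedding.sigmaMk_apply, Equiv.coe_toEmbedding]
    constructor
    · rintro rfl
      exact ⟨(e p).2, by simp⟩
    · rintro ⟨x, rfl⟩
      simp
  rw [hfib, Finset.card_map, Finset.card_univ, Fintype.card_fin]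

theorem theorem2 (δ : ℝ) (hδ : 0 < δ) :
    ∃ K : ℝ, 0 < K ∧ ∃ N₀ : ℕ, ∀ N : ℕ, N₀ ≤ N → ∀ c : ℝ, 1 ≤ c → c ≤ (N : ℝ) ^ (1 - δ) →
      ∀ (Ω : Type) (_ : MeasurableSpace Ω) (P : Measure Ω) (_ : IsProbabilityMeasure P)
        (A : Ω → RoundAlgorithm (Fin N)) (s : ℕ),
        SolvesNestedMatroidIntersection P A s ((N : ℝ) ^ c) →
          K * ((N : ℝ) ^ (1 / 3 : ℝ) / (c * Real.log N) ^ (1 / 3 : ℝ)) ≤ (s : ℝ) := by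
  refine ⟨1 / 400, by norm_num, ?_⟩
  -- With `c ≤ N ^ (1 - δ)` this yields `c * log N ≤ N / 400 ^ 3`, which makes `m` at least `1`.
  have hlogo : ∀ᶠ N : ℕ in Filter.atTop, Real.log N ≤ 1 / 400 ^ 3 * (N : ℝ) ^ δ := by
    have := ((isLittleO_log_rpow_atTop hδ).comp_tendsto tendsto_natCast_atTop_atTop).bound
      (show (0 : ℝ) < 1 / 400 ^ 3 by norm_num)
    filter_upwards [this] with N hN
    simp only [Function.comp_apply, Real.norm_eq_abs] at hN
    rw [abs_of_nonneg (a := (N : ℝ) ^ δ) (by positivity)] at hN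
    exact (le_abs_self _).trans hN
  obtain ⟨N₀, hN₀⟩ := Filter.eventually_atTop.1 (hlogo.and (Filter.eventually_ge_atTop 3))
  refine ⟨N₀, fun N hN c hc1 hc Ω _ P _ A s hA => ?_⟩
  obtain ⟨hlog, hN3⟩ := hN₀ N hN
  have hNr : (3 : ℝ) ≤ N := by exact_mod_cast hN3
  have hNpos : (0 : ℝ) < N := by linarith
  have hlog1 : 1 ≤ Real.log N := by
    rw [Real.le_log_iff_exp_le hNpos]
    linarith [Real.exp_one_lt_d9]
  set L := c * Real.log N with hL
  have hL1 : 1 ≤ L := by nlinarith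
  have hLN : L ≤ 1 / 400 ^ 3 * N := by
    calc L ≤ (N : ℝ) ^ (1 - δ) * (1 / 400 ^ 3 * (N : ℝ) ^ δ) := by rw [hL]; gcongr
      _ = 1 / 400 ^ 3 * ((N : ℝ) ^ (1 - δ) * (N : ℝ) ^ δ) := by ring
      _ = _ := by rw [← Real.rpow_add hNpos, sub_add_cancel, Real.rpow_one]
  rw [← Real.div_rpow hNpos.le (by linarith)]
  set X := (N : ℝ) / L with hX
  have hX400 : (400 : ℝ) ^ 3 ≤ X := by
    rw [hX, le_div_iff₀ (by linarith)]
    linarith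
  set Y := X ^ (1 / 3 : ℝ) with hY
  have hY3 : Y ^ 3 = X := by
    rw [hY, ← Real.rpow_natCast, ← Real.rpow_mul (by linarith)]
    norm_num
  have hY0 : 0 ≤ Y := Real.rpow_nonneg (by linarith) _
  have hY400 : 400 ≤ Y := by
    by_contra hlt
    push Not at hlt
    have := pow_lt_pow_left₀ hlt hY0 (show 3 ≠ 0 by norm_num)
    linarith
  set m := ⌊1 / 400 * Y⌋₊ with hmdef
  have hm1 : 1 ≤ m := Nat.le_floor (by push_cast; linarith)
  have hm1r : (1 : ℝ) ≤ m := by exact_mod_cast hm1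
  have hmY : (m : ℝ) ≤ 1 / 400 * Y := Nat.floor_le (by positivity)
  have hYm : 1 / 400 * Y < m + 1 := Nat.lt_floor_add_one _
  have hm3 : (m : ℝ) ^ 3 * L ≤ 1 / 400 ^ 3 * N := by
    calc (m : ℝ) ^ 3 * L ≤ (1 / 400 * Y) ^ 3 * L := by gcongr
      _ = 1 / 400 ^ 3 * (X * L) := by rw [mul_pow, hY3]; ring
      _ = _ := by rw [hX, div_mul_cancel₀ _ (by linarith)]
  set h := N / (104 * m ^ 2) with hhdef
  have hN104 : 104 * h * m ^ 2 ≤ N := by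
    calc 104 * h * m ^ 2 = 104 * m ^ 2 * h := by ring
      _ ≤ N := Nat.mul_div_le N _
  have hNlt : (N : ℝ) < 104 * m ^ 2 * (h + 1) := by
    exact_mod_cast Nat.lt_mul_div_succ N (show 0 < 104 * m ^ 2 by positivity)
  have hmL : 1 ≤ m * L := by nlinarith
  have hhL : 65536 * m * (3 * L) ≤ h := by
    -- As `400 ^ 3 / 104` is well above `3 * 65536`, the constant `400` leaves room for the factor
    -- `3`.
    have h1 : 400 ^ 3 * (m * L) < 104 * (h + 1) := by
      have hm2 : (0 : ℝ) < (m : ℝ) ^ 2 := by positivity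
      refine lt_of_mul_lt_mul_left ?_ hm2.le
      linarith
    linarith
  have hh4 : 4 ≤ h := by
    have : (4 : ℝ) ≤ h := by linarith
    exact_mod_cast this
  obtain ⟨w, hw, b, hb⟩ := exists_isStaircase hN104
  have hNc : (N : ℝ) ^ c = Real.exp L := by
    rw [Real.rpow_def_of_pos hNpos, mul_comm]
  have hexp : Real.exp (-(h / (65536 * m))) ≤ Real.exp (-(3 * L)) := by
    rw [Real.exp_le_exp, neg_le_neg_iff, le_div_iff₀ (by positivity)]
    linarith
  have hLlog : Real.log N ≤ L := by nlinarith
  have hNexp : (N : ℝ) ≤ Real.exp L := by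
    rw [← Real.exp_log hNpos]
    exact Real.exp_le_exp.2 hLlog
  have hmN : 72 * (m : ℝ) ^ 2 ≤ N := by
    have h1 : (104 : ℝ) * h * m ^ 2 ≤ N := by exact_mod_cast hN104
    have h2 : (1 : ℝ) ≤ h := by exact_mod_cast (by omega : 1 ≤ h)
    nlinarith [sq_nonneg (m : ℝ)]
  have hsmall : 2 * m * ((N : ℝ) ^ c * ((2 * m + 1) * (2 * Real.exp (-(h / (65536 * m)))))) <
      1 / 3 := by
    -- One factor `exp L` is the query budget `N ^ c`, the other dominates the polynomial in `m`.
    have hE : Real.exp L * Real.exp L * Real.exp (-(3 * L)) ≤ 1 := by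
      rw [← Real.exp_add, ← Real.exp_add, Real.exp_le_one_iff]
      linarith
    calc 2 * m * ((N : ℝ) ^ c * ((2 * m + 1) * (2 * Real.exp (-(h / (65536 * m))))))
        ≤ 2 * m * (Real.exp L * ((2 * m + 1) * (2 * Real.exp (-(3 * L))))) := by
          rw [hNc]
          gcongr
      _ = 4 * m * (2 * m + 1) * (Real.exp L * Real.exp (-(3 * L))) := by ring
      _ ≤ 1 / 6 * Real.exp L * (Real.exp L * Real.exp (-(3 * L))) := by
          have hpoly : 4 * (m : ℝ) * (2 * m + 1) ≤ 1 / 6 * Real.exp L := by nlinarith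
          exact mul_le_mul_of_nonneg_right hpoly (by positivity)
      _ = 1 / 6 * (Real.exp L * Real.exp L * Real.exp (-(3 * L))) := by ring
      _ < 1 / 3 := by linarith
  have hrounds := two_mul_le_rounds hm1 hh4 hw hb P (by positivity) hA hsmall
  have hrounds' : 2 * (m : ℝ) ≤ s := by exact_mod_cast hrounds
  -- The floor costs only a factor `2`: `Y / 400 < m + 1 ≤ 2 * m ≤ s`.
  linarith
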